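/- Let $G$ be a finite group and $\mathcal{C}$ a $G$-crossed braided spherical fusion category over $\mathbb{C}$: a spherical fusion category with a (not necessarily faithful) grading $\mathcal{C}=\bigoplus_{g\in G}\mathcal{C}_g$, $\mathcal{C}_g\otimes\mathcal{C}_h\subset\mathcal{C}_{gh}$, a $G$-action by pivotal monoidal autoequivalences $X\mapsto{}^gX$ with ${}^g(\mathcal{C}_h)\subset\mathcal{C}_{ghg^{-1}}$ and coherences ${}^g({}^hX)\cong{}^{gh}X$, $\varepsilon_X\colon{}^eX\cong X$, and a crossed braiding $c_{X,Y}\colon X\otimes Y\to{}^gY\otimes X$ for $X\in\mathcal{C}_g$, $Y\in\mathcal{C}$, which is natural, preserved by the action and satisfies the two hexagon axioms. For $A\in\mathcal{C}_e$ and $B\in\mathcal{C}_g$ let $$\Delta_{A,B}=\mathrm{tr}_B\big((1_{{}^gA}\otimes\varepsilon_B)\circ c_{{}^eB,A}\circ c_{A,B}\big)\colon A\to{}^gA$$ (partial trace over $B$), extended linearly in $B$ to formal complex linear combinations of simple objects of $\mathcal{C}_g$. Let $\Omega_g=\sum_X\dim(X)\,X$, the sum over representatives $X$ of the isomorphism classes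 of simple objects in $\mathcal{C}_g$, and let $\dim$ be extended linearly, so $\dim(\Omega_e)=\sum_{X}\dim(X)^2$ over simple $X$ in $\mathcal{C}_e$. An object $A\in\mathcal{C}_e$ is transparent if $(\varepsilon_A\otimes\varepsilon_B)\circ c_{{}^eB,A}\circ c_{A,B}=1_{A\otimes B}$ for all $B\in\mathcal{C}_e$. For $A\in\mathcal{C}_e$ let $\tau_A\colon A\to A$ be the idempotent given by projecting onto the maximal transparent subobject of $A$ and then including it into $A$; it exists and is unique. Let $g\in G$ with $\mathcal{C}_g\not\simeq0$. (1) For every $A\in\mathcal{C}_e$, $$\Delta_{{}^gA,\Omega_{g^{-1}}}\circ\Delta_{A,\Omega_g}=\dim(\Omega_e)^2\cdot\tau_A,$$ where the target ${}^{g^{-1}}({}^gA)$ of the left-hand side is identified with $A$ through the coherences of the action. (2) For every simple $X\in\mathcal{C}_e$, the morphism $\Delta_{X,\Omega_g}\colon X\to{}^gX$ is an isomorphism if and only if $X$ is transparent. If $X$ is transparent, then $\dim(\Omega_e)\neq0$ and the inverse of $\Delta_{X,\Omega_g}$ is $\dim(\Omega_e)^{-2}\cdot\Delta_{{}^gX,\Omega_{g^{-1}}}$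 (with ${}^{g^{-1}}({}^gX)$ identified with $X$). If $X$ is not transparent, then $\Delta_{X,\Omega_g}=0$. -/

import Mathlib

open CategoryTheory MonoidalCategory Limits

universe w v u

noncomputable section

namespace GCross

/-! ### Pivotal and spherical categories -/

section Pivotal

variable (C : Type u) [Category.{v} C] [MonoidalCategory C] [RigidCategory C]

/-- A pivotal structure on a rigid monoidal category: a monoidal natural isomorphism
`X ≅ X**` (where `Xᘁ` is the dual of `X`). -/
class PivotalCategory where
  /-- the isomorphism from an object to its double dual -/
  piv : ∀ X : C, X ≅ (Xᘁ)ᘁ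
  piv_naturality : ∀ {X Y : C} (f : X ⟶ Y), f ≫ (piv Y).hom = (piv X).hom ≫ (fᘁ)ᘁ
  /-- compatibility with tensor products, through the canonical isomorphism
  `(X ⊗ Y)** ≅ (Y* ⊗ X*)* ≅ X** ⊗ Y**` -/
  piv_tensor : ∀ X Y : C,
    (piv (X ⊗ Y)).hom ≫ ((rightDualTensorIso X Y).inv)ᘁ ≫ (rightDualTensorIso (Yᘁ) (Xᘁ)).hom =
      (piv X).hom ⊗ₘ (piv Y).hom

variable {C} [PivotalCategory C]

open PivotalCategory

/-- The evaluation `X ⊗ X* ⟶ 𝟙` on the other side, coming from the pivotal structure. -/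
def evPiv (X : C) : X ⊗ Xᘁ ⟶ 𝟙_ C :=
  (piv X).hom ▷ Xᘁ ≫ ε_ (Xᘁ) ((Xᘁ)ᘁ)

/-- The coevaluation `𝟙 ⟶ X* ⊗ X` on the other side, coming from the pivotal structure. -/
def coevPiv (X : C) : 𝟙_ C ⟶ Xᘁ ⊗ X :=
  η_ (Xᘁ) ((Xᘁ)ᘁ) ≫ Xᘁ ◁ (piv X).inv

/-- The right trace of an endomorphism. -/
def rightTrace {X : C} (f : X ⟶ X) : 𝟙_ C ⟶ 𝟙_ C :=
  η_ X (Xᘁ) ≫ f ▷ Xᘁ ≫ evPiv X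

/-- The left trace of an endomorphism. -/
def leftTrace {X : C} (f : X ⟶ X) : 𝟙_ C ⟶ 𝟙_ C :=
  coevPiv X ≫ Xᘁ ◁ f ≫ ε_ X (Xᘁ)

/-- The partial trace over the right tensor factor `B`. -/
def partialTrace {A A' : C} (B : C) (f : A ⊗ B ⟶ A' ⊗ B) : A ⟶ A' :=
  (ρ_ A).inv ≫ A ◁ η_ B (Bᘁ) ≫ (α_ A B (Bᘁ)).inv ≫ f ▷ Bᘁ ≫
    (α_ A' B (Bᘁ)).hom ≫ A' ◁ evPiv B ≫ (ρ_ A').hom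

variable (C) in
/-- A pivotal category is spherical if left and right traces agree. -/
class SphericalCategory : Prop where
  trace_eq : ∀ {X : C} (f : X ⟶ X), leftTrace f = rightTrace f

open Functor.LaxMonoidal Functor.OplaxMonoidal in
/-- A monoidal functor sends a dual pair to a dual pair. -/
abbrev mapExactPairing (F : C ⥤ C) [F.Monoidal] (X : C) :
    ExactPairing (F.obj X) (F.obj (Xᘁ)) where
  coevaluation' := ε F ≫ F.map (η_ X (Xᘁ)) ≫ δ F X (Xᘁ)
  evaluation' := μ F (Xᘁ) X ≫ F.map (ε_ X (Xᘁ)) ≫ η F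
  coevaluation_evaluation' := by
    calc
      _ = F.obj (Xᘁ) ◁ ε F ≫ μ F _ _ ≫
          F.map (Xᘁ ◁ η_ X (Xᘁ) ≫ (α_ _ _ _).inv ≫ ε_ X (Xᘁ) ▷ Xᘁ) ≫ δ F _ _ ≫ η F ▷ _ := by
        simp only [Functor.map_comp, Functor.Monoidal.map_whiskerLeft,
          Functor.Monoidal.map_whiskerRight, Functor.Monoidal.map_associator_inv,
          Category.assoc, MonoidalCategory.whiskerLeft_comp, comp_whiskerRight,
          Functor.Monoidal.μ_δ_assoc]
      _ = _ := by
        rw [ExactPairing.coevaluation_evaluation]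
        simp
  evaluation_coevaluation' := by
    calc
      _ = ε F ▷ F.obj X ≫ μ F _ _ ≫
          F.map (η_ X (Xᘁ) ▷ X ≫ (α_ _ _ _).hom ≫ X ◁ ε_ X (Xᘁ)) ≫ δ F _ _ ≫ _ ◁ η F := by
        simp only [Functor.map_comp, Functor.Monoidal.map_whiskerLeft,
          Functor.Monoidal.map_whiskerRight, Functor.Monoidal.map_associator,
          Category.assoc, MonoidalCategory.whiskerLeft_comp, comp_whiskerRight,
          Functor.Monoidal.μ_δ_assoc]
      _ = _ := by
        rw [ExactPairing.evaluation_coevaluation]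
        simp

/-- The canonical comparison `F(X*) ≅ F(X)*` of a monoidal functor. -/
def dualComparison (F : C ⥤ C) [F.Monoidal] (X : C) : F.obj (Xᘁ) ≅ (F.obj X)ᘁ :=
  rightDualIso (mapExactPairing F X) HasRightDual.exact

/-- A monoidal functor is pivotal if it carries the pivotal structure to the pivotal structure,
through the canonical isomorphisms `F(X**) ≅ F(X*)* ≅ F(X)**`. -/
def IsPivotalFunctor (F : C ⥤ C) [F.Monoidal] : Prop :=
  ∀ X : C, F.map (piv X).hom ≫ (dualComparison F (Xᘁ)).hom =
    (piv (F.obj X)).hom ≫ ((dualComparison F X).hom)ᘁ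

end Pivotal

/-! ### Fusion categories -/

attribute [local instance] Abelian.hasFiniteBiproducts

/-- `O` is a set of representatives of the isomorphism classes of simple objects. -/
def IsSimpleReps {C : Type u} [Category.{v} C] [HasZeroMorphisms C] (O : Finset C) : Prop :=
  (∀ X ∈ O, Simple X) ∧
  (∀ X ∈ O, ∀ Y ∈ O, Nonempty (X ≅ Y) → X = Y) ∧
  (∀ X : C, Simple X → ∃ Y ∈ O, Nonempty (X ≅ Y))

/-- A fusion category over `ℂ`: a `ℂ`-linear abelian rigid monoidal category with bilinear tensor
product and finite-dimensional morphism spaces, in which the unit is simple, there are finitely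
many simple objects up to isomorphism, and every object is a finite direct sum of simple ones. -/
class FusionCategory (C : Type u) [Category.{v} C] [Abelian C] [Linear ℂ C] [MonoidalCategory C]
    [MonoidalPreadditive C] [MonoidalLinear ℂ C] [RigidCategory C] : Prop where
  finite_hom : ∀ X Y : C, FiniteDimensional ℂ (X ⟶ Y)
  simple_unit : Simple (𝟙_ C)
  finite_simples : ∃ O : Finset C, IsSimpleReps O
  semisimple : ∀ X : C, ∃ (n : ℕ) (S : Fin n → C), (∀ i, Simple (S i)) ∧ Nonempty (X ≅ ⨁ S)

attribute [instance] FusionCategory.finite_hom FusionCategory.simple_unit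

section Crossed

variable (G : Type w) [Group G] [Finite G]
variable (C : Type u) [Category.{v} C] [Abelian C] [Linear ℂ C] [MonoidalCategory C]
  [MonoidalPreadditive C] [MonoidalLinear ℂ C] [RigidCategory C] [FusionCategory C]

section Dim

variable {C}

/-- The scalar `z` with `f = z • 𝟙`, for an endomorphism `f` of the (simple) unit object. -/
def unitScalar (f : 𝟙_ C ⟶ 𝟙_ C) : ℂ :=
  (endomorphism_simple_eq_smul_id ℂ f).choose

theorem unitScalar_smul_id (f : 𝟙_ C ⟶ 𝟙_ C) : unitScalar f • 𝟙 (𝟙_ C) = f :=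
  (endomorphism_simple_eq_smul_id ℂ f).choose_spec

/-- The categorical dimension of an object. -/
def qdim [PivotalCategory C] (X : C) : ℂ := unitScalar (rightTrace (𝟙 X))

end Dim

/-! ### `G`-crossed braided spherical fusion categories -/

/-- A (not necessarily faithful) `G`-grading: full subcategories `C_g` whose direct sum is `C`,
with `C_g ⊗ C_h ⊆ C_{gh}`. -/
structure Grading where
  /-- `deg g X` means that `X` lies in `C_g` -/
  deg : G → C → Prop
  deg_iso : ∀ {g : G} {X Y : C}, (X ≅ Y) → deg g X → deg g Y
  hom_eq_zero : ∀ {g h : G} {X Y : C}, g ≠ h → deg g X → deg h Y → ∀ f : X ⟶ Y, f = 0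
  decomposition : ∀ X : C, ∃ Y : G → C, (∀ g, deg g (Y g)) ∧ Nonempty (X ≅ ⨁ Y)
  deg_unit : deg 1 (𝟙_ C)
  deg_tensor : ∀ {g h : G} {X Y : C}, deg g X → deg h Y → deg (g * h) (X ⊗ Y)

/-- A `G`-action on a pivotal fusion category by linear pivotal monoidal autoequivalences, i.e. a
monoidal functor from the discrete monoidal category on `G`.
The isomorphisms `η(g, h)_X : ᵍ(ʰX) ≅ ᵏX` are indexed by `k` together with a proof of `g * h = k`,
so that the coherence laws can be written without transport along equalities in `G`. -/
structure PivotalAction [PivotalCategory C] where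
  /-- the functor `X ↦ ᵍX` -/
  act : G → C ⥤ C
  /-- the monoidal structure of `X ↦ ᵍX` -/
  [monoidal : ∀ g, (act g).Monoidal]
  [additive : ∀ g, (act g).Additive]
  [linear : ∀ g, (act g).Linear ℂ]
  pivotal : ∀ g, IsPivotalFunctor (act g)
  /-- the coherence `η(g, h)` -/
  mulIso : ∀ {g h k : G}, g * h = k → (act h ⋙ act g ≅ act k)
  /-- the coherence `ε` -/
  oneIso : act 1 ≅ 𝟭 C
  mulIso_monoidal : ∀ {g h k : G} (e : g * h = k), NatTrans.IsMonoidal (mulIso e).hom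
  oneIso_monoidal : NatTrans.IsMonoidal oneIso.hom
  assoc : ∀ {g h k gh hk ghk : G} (e₁ : g * h = gh) (e₂ : h * k = hk) (e₃ : gh * k = ghk)
    (e₄ : g * hk = ghk) (X : C),
    (mulIso e₁).hom.app ((act k).obj X) ≫ (mulIso e₃).hom.app X =
      (act g).map ((mulIso e₂).hom.app X) ≫ (mulIso e₄).hom.app X
  one_mul : ∀ (g : G) (X : C),
    (mulIso (_root_.one_mul g)).hom.app X = oneIso.hom.app ((act g).obj X)
  mul_one : ∀ (g : G) (X : C),
    (mulIso (_root_.mul_one g)).hom.app X = (act g).map (oneIso.hom.app X)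

attribute [instance] PivotalAction.monoidal PivotalAction.additive PivotalAction.linear

/-- The structure that makes a spherical fusion category `C` a `G`-crossed braided spherical fusion
category: a `G`-grading, a `G`-action with `ᵍ(C_h) ⊆ C_{ghg⁻¹}`, and a crossed braiding
`c_{X,Y} : X ⊗ Y ≅ ᵍY ⊗ X` for `X` in `C_g`. -/
structure CrossedBraided [PivotalCategory C] [SphericalCategory C] extends
    Grading G C, PivotalAction G C where
  deg_act : ∀ (g : G) {h : G} {X : C}, deg h X → deg (g * h * g⁻¹) ((act g).obj X)
  /-- the crossed braiding -/
  c : ∀ {g : G} {X : C} (_ : deg g X) (Y : C), X ⊗ Y ≅ (act g).obj Y ⊗ X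
  naturality_left : ∀ {g : G} {X X' : C} (hX : deg g X) (hX' : deg g X') (f : X ⟶ X') (Y : C),
    f ▷ Y ≫ (c hX' Y).hom = (c hX Y).hom ≫ (act g).obj Y ◁ f
  naturality_right : ∀ {g : G} {X : C} (hX : deg g X) {Y Y' : C} (f : Y ⟶ Y'),
    X ◁ f ≫ (c hX Y').hom = (c hX Y).hom ≫ (act g).map f ▷ X
  /-- the action preserves the crossed braiding -/
  act_c : ∀ (g : G) {h : G} {X : C} (hX : deg h X) (Y : C),
    Functor.LaxMonoidal.μ (act g) X Y ≫ (act g).map (c hX Y).hom ≫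
        Functor.OplaxMonoidal.δ (act g) ((act h).obj Y) X ≫
        (mulIso (rfl : g * h = g * h)).hom.app Y ▷ (act g).obj X =
      (c (deg_act g hX) ((act g).obj Y)).hom ≫
        (mulIso (inv_mul_cancel_right (g * h) g)).hom.app Y ▷ (act g).obj X
  /-- first hexagon: braiding past a tensor product `Y ⊗ Z` -/
  hexagon_right : ∀ {g : G} {X : C} (hX : deg g X) (Y Z : C),
    (c hX (Y ⊗ Z)).hom ≫ Functor.OplaxMonoidal.δ (act g) Y Z ▷ X =
      (α_ X Y Z).inv ≫ (c hX Y).hom ▷ Z ≫ (α_ ((act g).obj Y) X Z).hom ≫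
        (act g).obj Y ◁ (c hX Z).hom ≫ (α_ ((act g).obj Y) ((act g).obj Z) X).inv
  /-- second hexagon: braiding a tensor product `X ⊗ Y` past `Z` -/
  hexagon_left : ∀ {g h : G} {X Y : C} (hX : deg g X) (hY : deg h Y) (Z : C),
    (c (deg_tensor hX hY) Z).hom =
      (α_ X Y Z).hom ≫ X ◁ (c hY Z).hom ≫ (α_ X ((act h).obj Z) Y).inv ≫
        (c hX ((act h).obj Z)).hom ▷ Y ≫ (α_ ((act g).obj ((act h).obj Z)) X Y).hom ≫
        (mulIso (rfl : g * h = g * h)).hom.app Z ▷ (X ⊗ Y)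

end Crossed

namespace CrossedBraided

variable {G : Type w} [Group G] [Finite G]
variable {C : Type u} [Category.{v} C] [Abelian C] [Linear ℂ C] [MonoidalCategory C]
  [MonoidalPreadditive C] [MonoidalLinear ℂ C] [RigidCategory C] [FusionCategory C]
  [PivotalCategory C] [SphericalCategory C]
variable (K : CrossedBraided G C)

theorem deg_one_act {h : G} {X : C} (hX : K.deg h X) : K.deg h ((K.act 1).obj X) := by
  simpa using K.deg_act 1 hX

theorem deg_act_one (g : G) {X : C} (hX : K.deg 1 X) : K.deg 1 ((K.act g).obj X) := by
  simpa using K.deg_act g hX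

/-- The coherence isomorphism from `g⁻¹` acting on `ᵍA` to `A`. -/
def invActIso (g : G) (A : C) : (K.act g⁻¹).obj ((K.act g).obj A) ≅ A :=
  (K.mulIso (inv_mul_cancel g)).app A ≪≫ K.oneIso.app A

/-! ### Encirclings -/

/-- The double braiding `A ⊗ B ⟶ ᵍA ⊗ ᵉB` of `A ∈ C_e` and `B ∈ C_g`. -/
def doubleBraiding {g : G} {A B : C} (hA : K.deg 1 A) (hB : K.deg g B) :
    A ⊗ B ⟶ (K.act g).obj A ⊗ (K.act 1).obj B :=
  (K.c hA B).hom ≫ (K.c (K.deg_one_act hB) A).hom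

/-- The encircling `Δ_{A,B} : A ⟶ ᵍA` of `A ∈ C_e` by `B ∈ C_g`. -/
def encircling {g : G} {A B : C} (hA : K.deg 1 A) (hB : K.deg g B) : A ⟶ (K.act g).obj A :=
  partialTrace B (K.doubleBraiding hA hB ≫ (K.act g).obj A ◁ K.oneIso.hom.app B)

/-- The chosen simple objects of degree `g`. -/
def SimplesOfDegree (O : Finset C) (g : G) : Type u := {X : C // X ∈ O ∧ K.deg g X}

instance (O : Finset C) (g : G) : Fintype (K.SimplesOfDegree O g) :=
  have : Finite {X : C // X ∈ O ∧ K.deg g X} :=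
    Finite.of_injective (fun X => (⟨X.1, X.2.1⟩ : {X : C // X ∈ O}))
      fun _ _ h => Subtype.ext (congrArg (fun Z : {X : C // X ∈ O} => Z.1) h)
  Fintype.ofFinite {X : C // X ∈ O ∧ K.deg g X}

/-- The degree `g` part of the complexified fusion algebra: formal complex linear combinations of
the chosen simple objects of degree `g`. -/
abbrev GradedElement (O : Finset C) (g : G) : Type u := K.SimplesOfDegree O g → ℂ

/-- The Kirby colour `Ω_g = ⨁ dim(X) X`, over the chosen simple objects `X` of degree `g`. -/
def kirbyColour (O : Finset C) (g : G) : K.GradedElement O g := fun X => qdim X.1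

variable {K}

/-- The dimension, extended linearly to the fusion algebra. -/
def GradedElement.dim {O : Finset C} {g : G} (b : K.GradedElement O g) : ℂ :=
  ∑ X : K.SimplesOfDegree O g, b X * qdim X.1

/-- The encircling `Δ_{A,b} : A ⟶ ᵍA`, extended linearly to elements `b` of the fusion algebra. -/
def GradedElement.encircling {O : Finset C} {g : G} (b : K.GradedElement O g) {A : C}
    (hA : K.deg 1 A) : A ⟶ (K.act g).obj A :=
  ∑ X : K.SimplesOfDegree O g, b X • K.encircling hA X.2.2

variable (K)

/-! ### The symmetric centre of `C_e` -/

/-- `A` lies in the symmetric centre of the braided fusion category `C_e`: its double braiding with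
every object of `C_e` is trivial (up to the coherences `ᵉA ≅ A` and `ᵉB ≅ B`). -/
def IsTransparent (A : C) : Prop :=
  ∃ hA : K.deg 1 A, ∀ (B : C) (hB : K.deg 1 B),
    K.doubleBraiding hA hB ≫ (K.oneIso.hom.app A ⊗ₘ K.oneIso.hom.app B) = 𝟙 (A ⊗ B)

/-- `τ` is the idempotent given by the projection of `A` onto its maximal transparent subobject
`A'`, followed by the inclusion. -/
def IsTransparentProjection {A : C} (τ : A ⟶ A) : Prop :=
  ∃ (A' : C) (i : A' ⟶ A) (p : A ⟶ A'), K.IsTransparent A' ∧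
    (∀ (T : C) (m : T ⟶ A) [Mono m], K.IsTransparent T → ∃ k : T ⟶ A', k ≫ i = m) ∧
    i ≫ p = 𝟙 A' ∧ τ = p ≫ i

end CrossedBraided

end GCross

end

set_option linter.unusedSectionVars false

noncomputable section

namespace GCross

open PivotalCategory

attribute [local instance] Abelian.hasFiniteBiproducts

/-! ### Duality data of tensor products -/

section RightDual

variable {C : Type u} [Category.{v} C] [MonoidalCategory C]

/-! The engine is a handle slide (`handle_slide`). Let `φ_W : A ⊗ W ⟶ A' ⊗ W` be natural in `W` of
degree `hg`, and let `Y` have degree `h`. Tracing `φ_{Y ⊗ B}` over `B`, weighted by `dim B` over the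
simple `B` of degree `g`, gives the trace of `φ` over `Ω_{hg}`, tensored with `Y`. Indeed,
trace-dual bases of `Hom(Y ⊗ B, Z)` and `Hom(Z, Y ⊗ B)` resolve the identity of `Y ⊗ B`. By
sphericality their rotations are again trace-dual, and resolve the identity of `Z* ⊗ Y`. Both sides
expand into one double sum with the symmetric weight `dim B · dim Z`.

Take for `φ` the monodromy of `A`. The hexagons show that `Δ_{A,Ω_g}` followed by the monodromy
around `Y` is `Δ_{A,Ω_{hg}}` beside `Y` (`kirbyColour_encircling_slide`). Tracing over `Y` and
summing over degree `g⁻¹` turns the composite in (1) into `dim(Ω_{g⁻¹}) Δ_{A,Ω_e}`. The slide with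
`φ = 1` gives `dim(Ω_{g⁻¹}) = dim(Ω_e)`, since `C_g ≠ 0`. In trivial degree, the slide makes the
image of `Δ_{A,Ω_e}` transparent, while on transparent objects this map is the scalar `dim(Ω_e)`. By
naturality it is `dim(Ω_e) τ_A`. The scalar is nonzero because dimensions are real (`conj_qdim`), so
it is a sum of real squares with a positive term from the unit.

For (2), if a simple `X` is transparent, (1) provides the inverse. Otherwise `Δ_{X,Ω_e} = 0`, and
for a simple `S` in `C_g` the multiple `dim(S) Δ_{X,Ω_g}` factors through it. -/

theorem coevaluation_comp_rightDualIso_hom {X Y₁ Y₂ : C} (p₁ : ExactPairing X Y₁)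
    (p₂ : ExactPairing X Y₂) :
    (η_ X Y₁) ≫ X ◁ (rightDualIso p₁ p₂).hom = η_ X Y₂ := by
  have h := @coevaluation_comp_rightAdjointMate C _ _ X X ⟨Y₂⟩ ⟨Y₁⟩ (𝟙 X)
  simpa [rightDualIso] using h

theorem rightDualIso_hom_comp_evaluation {X Y₁ Y₂ : C} (p₁ : ExactPairing X Y₁)
    (p₂ : ExactPairing X Y₂) :
    (rightDualIso p₁ p₂).hom ▷ X ≫ (ε_ X Y₂) = ε_ X Y₁ := by
  have h := @rightAdjointMate_comp_evaluation C _ _ X X ⟨Y₂⟩ ⟨Y₁⟩ (𝟙 X)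
  simpa [rightDualIso] using h

variable [RigidCategory C]

theorem coevaluation_comp_rightDualTensorIso_hom (X Y : C) :
    (η_ (X ⊗ Y) ((X ⊗ Y)ᘁ)) ≫ (X ⊗ Y) ◁ (rightDualTensorIso X Y).hom =
      η_ X Xᘁ ⊗≫ X ◁ η_ Y Yᘁ ▷ Xᘁ ⊗≫ 𝟙 _ := by
  rw [rightDualTensorIso, coevaluation_comp_rightDualIso_hom, ExactPairing.tensor_coevaluation]
  monoidal

theorem rightDualTensorIso_inv_comp_evaluation (X Y : C) :
    (rightDualTensorIso X Y).inv ▷ (X ⊗ Y) ≫ (ε_ (X ⊗ Y) ((X ⊗ Y)ᘁ)) =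
      𝟙 _ ⊗≫ (Yᘁ : C) ◁ (ε_ X Xᘁ) ▷ Y ⊗≫ ε_ Y (Yᘁ : C) := by
  rw [← rightDualIso_hom_comp_evaluation (HasRightDual.exact (X := X ⊗ Y))
    (ExactPairing.tensor (X₁ := X) (X₂ := Y) (Y₁ := (Xᘁ : C)) (Y₂ := (Yᘁ : C)))]
  change _ ≫ (rightDualTensorIso X Y).hom ▷ _ ≫ _ = _
  rw [inv_hom_whiskerRight_assoc, ExactPairing.tensor_evaluation]

end RightDual

/-! ### Traces and partial traces in pivotal categories -/

section Pivotal

variable {C : Type u} [Category.{v} C] [MonoidalCategory C] [RigidCategory C]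
  [PivotalCategory C]

/-- The exact pairing of `X*` and `X` coming from the pivotal structure. -/
abbrev pivotalPairing (X : C) : ExactPairing Xᘁ X :=
  exactPairingCongrRight (piv X)

theorem coevPiv_whiskerRight_comp (X : C) :
    coevPiv X ▷ Xᘁ ≫ (α_ Xᘁ X Xᘁ).hom ≫ Xᘁ ◁ evPiv X = (λ_ Xᘁ).hom ≫ (ρ_ Xᘁ).inv :=
  (pivotalPairing X).evaluation_coevaluation'

theorem whiskerLeft_rightAdjointMate_comp_evPiv {X Y : C} (f : X ⟶ Y) :
    X ◁ fᘁ ≫ evPiv X = f ▷ Yᘁ ≫ evPiv Y := by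
  have h := rightAdjointMate_comp_evaluation (fᘁ)
  rw [evPiv, evPiv, ← comp_whiskerRight_assoc, piv_naturality, comp_whiskerRight_assoc, h,
    whisker_exchange_assoc]

theorem coevPiv_comp_rightAdjointMate {X Y : C} (f : X ⟶ Y) :
    coevPiv Y ≫ fᘁ ▷ Y = coevPiv X ≫ Xᘁ ◁ f := by
  have h := coevaluation_comp_rightAdjointMate (fᘁ)
  have h' : f ≫ (piv Y).hom = (piv X).hom ≫ (fᘁ)ᘁ := piv_naturality f
  have h'' : (piv X).inv ≫ f = (fᘁ)ᘁ ≫ (piv Y).inv := by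
    rw [Iso.inv_comp_eq, ← Category.assoc, ← h']; simp
  rw [coevPiv, coevPiv, Category.assoc, Category.assoc, ← MonoidalCategory.whiskerLeft_comp, h'',
    MonoidalCategory.whiskerLeft_comp, whisker_exchange, reassoc_of% h]

/-- `f` travels around the loop: it crosses the coevaluation as its mate, and returns across `evPiv`
because `piv` is natural. -/
theorem rightTrace_comm {X Y : C} (f : X ⟶ Y) (g : Y ⟶ X) :
    rightTrace (f ≫ g) = rightTrace (g ≫ f) := by
  rw [rightTrace, rightTrace, comp_whiskerRight, comp_whiskerRight, Category.assoc, Category.assoc,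
    ← coevaluation_comp_rightAdjointMate_assoc, whisker_exchange_assoc,
    whiskerLeft_rightAdjointMate_comp_evPiv]

theorem leftTrace_comm {X Y : C} (f : X ⟶ Y) (g : Y ⟶ X) :
    leftTrace (f ≫ g) = leftTrace (g ≫ f) := by
  have h := coevPiv_comp_rightAdjointMate f
  rw [leftTrace, leftTrace, MonoidalCategory.whiskerLeft_comp, MonoidalCategory.whiskerLeft_comp,
    Category.assoc, Category.assoc, ← reassoc_of% h, ← whisker_exchange_assoc,
    rightAdjointMate_comp_evaluation]

/-- The evaluation of a tensor product is nested. -/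
theorem rightDualTensorIso_inv_comp_evPiv (X Y : C) :
    (X ⊗ Y) ◁ (rightDualTensorIso X Y).inv ≫ evPiv (X ⊗ Y) =
      𝟙 _ ⊗≫ X ◁ evPiv Y ▷ Xᘁ ⊗≫ evPiv X := by
  have h := rightAdjointMate_comp_evaluation ((rightDualTensorIso X Y).inv)
  have h2 := rightDualIso_hom_comp_evaluation
    (HasRightDual.exact (X := (Yᘁ ⊗ Xᘁ : C)))
    (ExactPairing.tensor (X₁ := (Yᘁ : C)) (X₂ := (Xᘁ : C))
      (Y₂ := ((Xᘁ)ᘁ : C)) (Y₁ := ((Yᘁ)ᘁ : C)))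
  have h3 := piv_tensor X Y
  rw [evPiv, whisker_exchange_assoc, ← h, ← h2]
  change _ ≫ _ ≫ (rightDualTensorIso Yᘁ Xᘁ).hom ▷ _ ≫ _ = _
  rw [← comp_whiskerRight_assoc, ← comp_whiskerRight_assoc, Category.assoc, h3,
    ExactPairing.tensor_evaluation, evPiv, evPiv, tensorHom_def']
  calc
    _ = 𝟙 _ ⊗≫ X ◁ (piv Y).hom ▷ (Yᘁ : C) ▷ (Xᘁ : C) ⊗≫
        ((piv X).hom ▷ ((Yᘁ)ᘁ ⊗ Yᘁ : C) ≫ ((Xᘁ)ᘁ : C) ◁ ε_ (Yᘁ : C) ((Yᘁ)ᘁ : C)) ▷ (Xᘁ : C) ⊗≫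
        ε_ (Xᘁ : C) ((Xᘁ)ᘁ : C) := by monoidal
    _ = _ := by rw [← whisker_exchange]; monoidal

theorem coevPiv_comp_rightDualTensorIso_hom (X Y : C) :
    coevPiv (X ⊗ Y) ≫ (rightDualTensorIso X Y).hom ▷ (X ⊗ Y) =
      coevPiv Y ⊗≫ (Yᘁ : C) ◁ coevPiv X ▷ Y ⊗≫ 𝟙 _ := by
  have h := coevaluation_comp_rightAdjointMate ((rightDualTensorIso X Y).hom)
  let P : ExactPairing (Yᘁ ⊗ Xᘁ : C) ((Xᘁ)ᘁ ⊗ (Yᘁ)ᘁ) := ExactPairing.tensor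
  have h2 := coevaluation_comp_rightDualIso_hom P (HasRightDual.exact (X := (Yᘁ ⊗ Xᘁ : C)))
  have h2' : (rightDualIso P (HasRightDual.exact (X := (Yᘁ ⊗ Xᘁ : C)))).hom =
    (rightDualTensorIso Yᘁ Xᘁ).inv := rfl
  have h3 := piv_tensor X Y
  have h4 : (rightDualTensorIso Yᘁ Xᘁ).inv ≫ ((rightDualTensorIso X Y).hom)ᘁ ≫
      (piv (X ⊗ Y)).inv = (piv X).inv ⊗ₘ (piv Y).inv := by
    rw [← cancel_epi ((piv X).hom ⊗ₘ (piv Y).hom), tensorHom_comp_tensorHom, Iso.hom_inv_id,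
      Iso.hom_inv_id, ← h3]
    have hr' : ((rightDualTensorIso X Y).inv)ᘁ ≫ ((rightDualTensorIso X Y).hom)ᘁ = 𝟙 _ := by
      rw [← comp_rightAdjointMate]; simp
    simp [reassoc_of% hr']
  rw [coevPiv, Category.assoc, whisker_exchange, ← reassoc_of% h, ← h2, h2', Category.assoc,
    ← MonoidalCategory.whiskerLeft_comp, ← MonoidalCategory.whiskerLeft_comp, h4,
    ExactPairing.tensor_coevaluation, coevPiv, coevPiv, tensorHom_def']
  calc
    _ = η_ (Yᘁ : C) ((Yᘁ)ᘁ : C) ⊗≫ (Yᘁ : C) ◁ (η_ (Xᘁ : C) ((Xᘁ)ᘁ : C) ▷ ((Yᘁ)ᘁ : C) ≫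
          (Xᘁ ⊗ (Xᘁ)ᘁ : C) ◁ (piv Y).inv) ⊗≫
        (Yᘁ : C) ◁ (Xᘁ : C) ◁ (piv X).inv ▷ Y ⊗≫ 𝟙 _ := by monoidal
    _ = _ := by rw [← whisker_exchange]; monoidal

/-- The partial trace over the left tensor factor `Z`. -/
def leftPartialTrace (Z : C) {W W' : C} (f : Z ⊗ W ⟶ Z ⊗ W') : W ⟶ W' :=
  (λ_ W).inv ≫ coevPiv Z ▷ W ≫ (α_ Zᘁ Z W).hom ≫ Zᘁ ◁ f ≫ (α_ Zᘁ Z W').inv ≫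
    (ε_ Z Zᘁ) ▷ W' ≫ (λ_ W').hom

/-- Monoidality of the pivotal structure nests the loop of `Y` inside that of `X`, so the inner one
can be closed first. -/
theorem rightTrace_tensor {X Y : C} (f : X ⊗ Y ⟶ X ⊗ Y) :
    rightTrace f = rightTrace (partialTrace Y f) := by
  calc
    _ = (η_ (X ⊗ Y) (X ⊗ Y)ᘁ ≫ (X ⊗ Y) ◁ (rightDualTensorIso X Y).hom) ≫
          f ▷ (Yᘁ ⊗ Xᘁ) ≫ ((X ⊗ Y) ◁ (rightDualTensorIso X Y).inv ≫ evPiv (X ⊗ Y)) := by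
      rw [Category.assoc, ← whisker_exchange_assoc,
        whiskerLeft_hom_inv_assoc, rightTrace]
    _ = _ := by
      rw [coevaluation_comp_rightDualTensorIso_hom, rightDualTensorIso_inv_comp_evPiv, rightTrace,
        partialTrace]
      monoidal

theorem leftTrace_tensor {X Y : C} (f : X ⊗ Y ⟶ X ⊗ Y) :
    leftTrace f = leftTrace (leftPartialTrace X f) := by
  calc
    _ = (coevPiv (X ⊗ Y) ≫ (rightDualTensorIso X Y).hom ▷ (X ⊗ Y)) ≫
          (Yᘁ ⊗ Xᘁ) ◁ f ≫ ((rightDualTensorIso X Y).inv ▷ (X ⊗ Y) ≫ ε_ (X ⊗ Y) (X ⊗ Y)ᘁ) := by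
      rw [Category.assoc, whisker_exchange_assoc,
        hom_inv_whiskerRight_assoc, leftTrace]
    _ = _ := by
      rw [coevPiv_comp_rightDualTensorIso_hom, rightDualTensorIso_inv_comp_evaluation, leftTrace,
        leftPartialTrace]
      monoidal

theorem comp_partialTrace {A' A A'' : C} (B : C) (a : A' ⟶ A) (f : A ⊗ B ⟶ A'' ⊗ B) :
    partialTrace B (a ▷ B ≫ f) = a ≫ partialTrace B f := by
  simp only [partialTrace, comp_whiskerRight, Category.assoc]
  calc
    _ = 𝟙 _ ⊗≫ (A' ◁ η_ B Bᘁ ≫ a ▷ (B ⊗ Bᘁ)) ⊗≫ f ▷ Bᘁ ⊗≫ A'' ◁ evPiv B ⊗≫ 𝟙 _ := by monoidal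
    _ = _ := by rw [whisker_exchange]; monoidal

theorem partialTrace_comp {A' A A'' : C} (B : C) (f : A ⊗ B ⟶ A' ⊗ B) (a : A' ⟶ A'') :
    partialTrace B (f ≫ a ▷ B) = partialTrace B f ≫ a := by
  simp only [partialTrace, comp_whiskerRight, Category.assoc]
  calc
    _ = 𝟙 _ ⊗≫ A ◁ η_ B Bᘁ ⊗≫ f ▷ Bᘁ ⊗≫ (a ▷ (B ⊗ Bᘁ) ≫ A'' ◁ evPiv B) ⊗≫ 𝟙 _ := by monoidal
    _ = _ := by rw [← whisker_exchange]; monoidal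

end Pivotal

/-! ### Rotation of fusion and splitting morphisms -/

section Rotation

variable {C : Type u} [Category.{v} C] [MonoidalCategory C] [RigidCategory C]

/-- Rotation of the target of a morphism `Y ⊗ B ⟶ Z` to the source, and of `B` to the target. -/
def rotateFusion {Y B Z : C} (p : Y ⊗ B ⟶ Z) : Zᘁ ⊗ Y ⟶ Bᘁ :=
  (tensorLeftHomEquiv Y Z Zᘁ Bᘁ).symm (tensorRightHomEquiv Y B Bᘁ Z p)

theorem rotateFusion_eq {Y B Z : C} (p : Y ⊗ B ⟶ Z) :
    rotateFusion p = Zᘁ ◁ ((ρ_ Y).inv ≫ Y ◁ η_ B Bᘁ ≫ (α_ Y B Bᘁ).inv ≫ p ▷ Bᘁ) ≫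
      (α_ Zᘁ Z Bᘁ).inv ≫ (ε_ Z Zᘁ) ▷ Bᘁ ≫ (λ_ Bᘁ).hom := rfl

variable [PivotalCategory C]

/-- Rotation of morphisms `Z ⟶ Y ⊗ B` into morphisms `B* ⟶ Z* ⊗ Y`. -/
def rotateSplitting (Y B Z : C) : (Z ⟶ Y ⊗ B) ≃ (Bᘁ ⟶ Zᘁ ⊗ Y) :=
  letI := pivotalPairing B
  letI := pivotalPairing Z
  (tensorRightHomEquiv Z Bᘁ B Y).symm.trans (tensorLeftHomEquiv Bᘁ Zᘁ Z Y)

theorem rotateSplitting_apply {Y B Z : C} (q : Z ⟶ Y ⊗ B) :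
    rotateSplitting Y B Z q = (λ_ Bᘁ).inv ≫ coevPiv Z ▷ Bᘁ ≫ (α_ Zᘁ Z Bᘁ).hom ≫
      Zᘁ ◁ (q ▷ Bᘁ ≫ (α_ Y B Bᘁ).hom ≫ Y ◁ evPiv B ≫ (ρ_ Y).hom) := rfl

/-- Both traces close the same diagram on the sphere. Closing `B` on the right leaves an
endomorphism of `Y`. Its right trace becomes a left one by sphericality; cyclicity then moves it to
`Z ⊗ B*`, where `Z` is closed on the left. -/
theorem rightTrace_rotate [SphericalCategory C] {Y B Z : C} (q : Z ⟶ Y ⊗ B) (p : Y ⊗ B ⟶ Z) :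
    rightTrace (rotateSplitting Y B Z q ≫ rotateFusion p) = rightTrace (q ≫ p) := by
  rw [rightTrace_comm q p, rightTrace_tensor, ← SphericalCategory.trace_eq,
    ← SphericalCategory.trace_eq]
  have h : partialTrace B (p ≫ q) =
      ((ρ_ Y).inv ≫ Y ◁ η_ B Bᘁ ≫ (α_ Y B Bᘁ).inv ≫ p ▷ Bᘁ) ≫
        (q ▷ Bᘁ ≫ (α_ Y B Bᘁ).hom ≫ Y ◁ evPiv B ≫ (ρ_ Y).hom) := by
    simp [partialTrace]
  rw [h, leftTrace_comm ((ρ_ Y).inv ≫ _), leftTrace_tensor, rotateSplitting_apply, rotateFusion_eq,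
    leftPartialTrace]
  simp only [Category.assoc, MonoidalCategory.whiskerLeft_comp]

/-- The operator `A ⊗ Y ⟶ A' ⊗ Y` which creates a loop of `Z`, applies `φ` to `A ⊗ Z`, applies `t`
to the returning part of the loop and `Y`, and then closes the loop. -/
def loopAlong {A A' Z : C} (φ : A ⊗ Z ⟶ A' ⊗ Z) {Y : C} (t : Zᘁ ⊗ Y ⟶ Zᘁ ⊗ Y) :
    A ⊗ Y ⟶ A' ⊗ Y :=
  𝟙 _ ⊗≫ A ◁ η_ Z Zᘁ ▷ Y ⊗≫ φ ▷ (Zᘁ ⊗ Y : C) ⊗≫ A' ◁ Z ◁ t ⊗≫ A' ◁ evPiv Z ▷ Y ⊗≫ 𝟙 _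

theorem loopAlong_id {A A' Z : C} (φ : A ⊗ Z ⟶ A' ⊗ Z) (Y : C) :
    loopAlong φ (𝟙 (Zᘁ ⊗ Y)) = partialTrace Z φ ▷ Y := by
  simp only [loopAlong, partialTrace, MonoidalCategory.whiskerLeft_id]
  monoidal

/-- The local move of the handle slide: bending turns a loop of `B` that fuses with `Y` into `Z`
into a loop of `Z` that meets `Y` through `B*`. -/
theorem partialTrace_fusion_splitting {A A' Y B Z : C} (φ : A ⊗ Z ⟶ A' ⊗ Z) (p : Y ⊗ B ⟶ Z)
    (q : Z ⟶ Y ⊗ B) :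
    partialTrace B ((α_ A Y B).hom ≫ A ◁ p ≫ φ ≫ A' ◁ q ≫ (α_ A' Y B).inv) =
      loopAlong φ (rotateFusion p ≫ rotateSplitting Y B Z q) := by
  have hn : (ρ_ Y).inv ≫ Y ◁ η_ B Bᘁ ≫ (α_ Y B Bᘁ).inv ≫ p ▷ Bᘁ =
      (λ_ Y).inv ≫ η_ Z Zᘁ ▷ Y ≫ (α_ Z Zᘁ Y).hom ≫ Z ◁ rotateFusion p :=
    ((tensorLeftHomEquiv Y Z Zᘁ Bᘁ).apply_symm_apply (tensorRightHomEquiv Y B Bᘁ Z p)).symm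
  have hm : q ▷ Bᘁ ≫ (α_ Y B Bᘁ).hom ≫ Y ◁ evPiv B ≫ (ρ_ Y).hom =
      Z ◁ rotateSplitting Y B Z q ≫ (α_ Z Zᘁ Y).inv ≫ evPiv Z ▷ Y ≫ (λ_ Y).hom :=
    letI := pivotalPairing B
    letI := pivotalPairing Z
    ((tensorLeftHomEquiv Bᘁ Zᘁ Z Y).symm_apply_apply
      ((tensorRightHomEquiv Z Bᘁ B Y).symm q)).symm
  calc
    _ = A ◁ ((ρ_ Y).inv ≫ Y ◁ η_ B Bᘁ ≫ (α_ Y B Bᘁ).inv ≫ p ▷ Bᘁ) ⊗≫ φ ▷ (Bᘁ : C) ⊗≫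
        A' ◁ (q ▷ Bᘁ ≫ (α_ Y B Bᘁ).hom ≫ Y ◁ evPiv B ≫ (ρ_ Y).hom) := by
      rw [partialTrace]
      monoidal
    _ = 𝟙 _ ⊗≫ A ◁ η_ Z Zᘁ ▷ Y ⊗≫ ((A ⊗ Z) ◁ rotateFusion p ≫ φ ▷ (Bᘁ : C)) ⊗≫
        A' ◁ Z ◁ rotateSplitting Y B Z q ⊗≫ A' ◁ evPiv Z ▷ Y ⊗≫ 𝟙 _ := by
      rw [hn, hm]
      monoidal
    _ = _ := by
      rw [whisker_exchange, loopAlong]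
      monoidal

end Rotation

/-- The isomorphism between duals induced by an isomorphism. -/
def rightDualMapIso {C : Type u} [Category.{v} C] [MonoidalCategory C] [RigidCategory C]
    {X Y : C} (e : X ≅ Y) : Yᘁ ≅ Xᘁ where
  hom := (e.hom)ᘁ
  inv := (e.inv)ᘁ
  hom_inv_id := by rw [← comp_rightAdjointMate]; simp
  inv_hom_id := by rw [← comp_rightAdjointMate]; simp

/-! ### Semisimplicity and Schur's lemma -/

section Semisimple

variable {C : Type u} [Category.{v} C] [Abelian C] [Linear ℂ C] [MonoidalCategory C]
  [MonoidalPreadditive C] [MonoidalLinear ℂ C] [RigidCategory C] [FusionCategory C]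

theorem exists_retraction_of_simple {S W : C} [Simple S] (q : S ⟶ W) (hq : q ≠ 0) :
    ∃ p : W ⟶ S, q ≫ p = 𝟙 S := by
  obtain ⟨n, T, hT, ⟨e⟩⟩ := FusionCategory.semisimple W
  have : ∃ i, q ≫ e.hom ≫ biproduct.π T i ≠ 0 := by
    by_contra! h
    apply hq
    rw [← cancel_mono e.hom]
    ext i
    simpa using h i
  obtain ⟨i, hi⟩ := this
  have := hT i
  have := isIso_of_hom_simple hi
  exact ⟨e.hom ≫ biproduct.π T i ≫ inv (q ≫ e.hom ≫ biproduct.π T i), by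
    simpa only [Category.assoc] using IsIso.hom_inv_id (q ≫ e.hom ≫ biproduct.π T i)⟩

theorem eq_zero_of_simple_comp_eq_zero {W V : C} (f : W ⟶ V)
    (h : ∀ (S : C) [Simple S] (r : S ⟶ W), r ≫ f = 0) : f = 0 := by
  obtain ⟨n, T, hT, ⟨e⟩⟩ := FusionCategory.semisimple W
  rw [← cancel_epi e.inv]
  ext i
  have := hT i
  simpa using h (T i) (biproduct.ι T i ≫ e.inv)

theorem simple_of_endomorphisms_scalar {W : C} (hW : 𝟙 W ≠ 0)
    (h : ∀ f : W ⟶ W, ∃ c : ℂ, f = c • 𝟙 W) : Simple W := by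
  obtain ⟨S, hS, r, hr⟩ : ∃ (S : C) (_ : Simple S) (r : S ⟶ W), r ≠ 0 := by
    by_contra! h'
    exact hW (eq_zero_of_simple_comp_eq_zero _ fun S hS r => by simpa using h' S hS r)
  obtain ⟨p, hp⟩ := exists_retraction_of_simple r hr
  obtain ⟨c, hc⟩ := h (p ≫ r)
  have hc1 : c = 1 := by
    have h1 : r ≫ p ≫ r = c • r := by rw [hc]; simp
    rw [reassoc_of% hp] at h1
    by_contra hne
    refine hr ((smul_eq_zero.mp (?_ : (1 - c) • r = 0)).resolve_left
      (sub_ne_zero.mpr (Ne.symm hne)))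
    rw [sub_smul, one_smul, ← h1, sub_self]
  exact Simple.of_iso (Y := S) ⟨p, r, by rw [hc, hc1, one_smul], hp⟩

/-- Endomorphisms of `B*` slide across the coevaluation to endomorphisms of `B`, hence are scalars.
-/
theorem simple_rightDual (B : C) [Simple B] : Simple Bᘁ := by
  apply simple_of_endomorphisms_scalar
  · intro h
    refine id_nonzero B ?_
    have h1 := ExactPairing.evaluation_coevaluation B Bᘁ
    have h2 : (η_ B Bᘁ) = 0 := by
      rw [← Category.comp_id (η_ B Bᘁ), ← MonoidalCategory.whiskerLeft_id, h]
      simp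
    rw [h2] at h1
    rw [← cancel_epi (λ_ B).hom, ← cancel_mono (ρ_ B).inv]
    simpa using h1.symm
  · intro f
    obtain ⟨g, hg⟩ : ∃ g : B ⟶ B, (η_ B Bᘁ) ≫ B ◁ f = η_ B Bᘁ ≫ g ▷ Bᘁ := by
      refine ⟨(λ_ B).inv ≫ (tensorRightHomEquiv (𝟙_ C) B Bᘁ B).symm (η_ B Bᘁ ≫ B ◁ f), ?_⟩
      conv_lhs => rw [← (tensorRightHomEquiv (𝟙_ C) B Bᘁ B).apply_symm_apply (η_ B Bᘁ ≫ B ◁ f)]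
      generalize (tensorRightHomEquiv (𝟙_ C) B Bᘁ B).symm (η_ B Bᘁ ≫ B ◁ f) = t
      change (ρ_ _).inv ≫ _ ◁ η_ B Bᘁ ≫ (α_ _ _ _).inv ≫ t ▷ Bᘁ = _
      monoidal
    obtain ⟨c, hc⟩ := endomorphism_simple_eq_smul_id ℂ g
    refine ⟨c, ?_⟩
    have h1 : (η_ B Bᘁ) ≫ B ◁ f = η_ B Bᘁ ≫ B ◁ (c • 𝟙 (Bᘁ)) := by
      rw [hg, ← hc]
      simp
    rw [← (tensorLeftHomEquiv (𝟙_ C) B Bᘁ Bᘁ).symm.injective.eq_iff] at h1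
    simp only [tensorLeftHomEquiv_symm_coevaluation_comp_whiskerLeft] at h1
    exact (cancel_epi _).mp h1

theorem unitScalar_eq_iff (f : 𝟙_ C ⟶ 𝟙_ C) (c : ℂ) : unitScalar f = c ↔ f = c • 𝟙 (𝟙_ C) := by
  constructor
  · rintro rfl
    exact (unitScalar_smul_id f).symm
  · intro h
    by_contra hne
    refine id_nonzero (𝟙_ C) ((smul_eq_zero.mp
      (?_ : (unitScalar f - c) • 𝟙 (𝟙_ C) = 0)).resolve_left (sub_ne_zero.mpr hne))
    rw [sub_smul, unitScalar_smul_id, h, sub_self]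

/-! ### Dimensions and trace-dual bases -/

section Pivotal

variable [PivotalCategory C]

/-- The scalar-valued right trace, as a linear functional. -/
def trace (X : C) : (X ⟶ X) →ₗ[ℂ] ℂ where
  toFun f := unitScalar (rightTrace f)
  map_add' f g := by
    rw [unitScalar_eq_iff, add_smul, unitScalar_smul_id, unitScalar_smul_id]
    simp [rightTrace, MonoidalPreadditive.add_whiskerRight]
  map_smul' c f := by
    rw [unitScalar_eq_iff, smul_eq_mul, mul_smul, RingHom.id_apply, unitScalar_smul_id]
    simp [rightTrace, MonoidalLinear.smul_whiskerRight]

theorem trace_smul_id {X : C} (f : X ⟶ X) : trace X f • 𝟙 (𝟙_ C) = rightTrace f :=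
  unitScalar_smul_id _

theorem trace_id (X : C) : trace X (𝟙 X) = qdim X := rfl

theorem trace_comm {X Y : C} (f : X ⟶ Y) (g : Y ⟶ X) : trace X (f ≫ g) = trace Y (g ≫ f) := by
  change unitScalar _ = unitScalar _
  rw [rightTrace_comm]

theorem qdim_congr {X Y : C} (e : X ≅ Y) : qdim X = qdim Y := by
  rw [← trace_id, ← trace_id, ← e.hom_inv_id, trace_comm, e.inv_hom_id]

/-- The nonzero coevaluation has a retraction. Since `Hom(S ⊗ S*, 𝟙) ≅ End S` is one-dimensional,
the retraction is a multiple of `evPiv S`, which therefore cannot kill the coevaluation. -/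
theorem qdim_ne_zero (S : C) [Simple S] : qdim S ≠ 0 := by
  have hη : (η_ S Sᘁ) ≠ 0 := by
    intro h2
    have h1 := ExactPairing.evaluation_coevaluation S Sᘁ
    rw [h2] at h1
    refine id_nonzero S ?_
    rw [← cancel_epi (λ_ S).hom, ← cancel_mono (ρ_ S).inv]
    simpa using h1.symm
  obtain ⟨p, hp⟩ := exists_retraction_of_simple _ hη
  obtain ⟨g, rfl⟩ : ∃ g : S ⟶ S, g ▷ Sᘁ ≫ evPiv S = p := by
    let := pivotalPairing S
    refine ⟨(tensorRightHomEquiv S Sᘁ S (𝟙_ C)) p ≫ (λ_ S).hom, ?_⟩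
    conv_rhs => rw [← (tensorRightHomEquiv S Sᘁ S (𝟙_ C)).symm_apply_apply p]
    change _ = _ ▷ _ ≫ (α_ _ _ _).hom ≫ _ ◁ evPiv S ≫ _
    monoidal
  obtain ⟨c, rfl⟩ := endomorphism_simple_eq_smul_id ℂ g
  intro h0
  have h1 : rightTrace (𝟙 S) = 0 := by
    rw [← trace_smul_id, trace_id, h0, zero_smul]
  refine id_nonzero (𝟙_ C) ?_
  rw [rightTrace, id_whiskerRight, Category.id_comp] at h1
  rw [← hp, MonoidalLinear.smul_whiskerRight, id_whiskerRight, Linear.smul_comp,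
    Category.id_comp, Linear.comp_smul, h1, smul_zero]

theorem eq_smul_id_of_simple {S : C} [Simple S] (f : S ⟶ S) :
    f = (trace S f / qdim S) • 𝟙 S := by
  obtain ⟨c, rfl⟩ := endomorphism_simple_eq_smul_id ℂ f
  rw [map_smul, trace_id, smul_eq_mul, mul_div_cancel_right₀ _ (qdim_ne_zero S)]

theorem partialTrace_whiskerRight {A A' : C} (B : C) (f : A ⟶ A') :
    partialTrace B (f ▷ B) = qdim B • f := by
  have h (A : C) : partialTrace B (𝟙 (A ⊗ B)) = (ρ_ A).inv ≫ A ◁ rightTrace (𝟙 B) ≫ (ρ_ A).hom := by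
    simp [partialTrace, rightTrace]
  rw [← Category.comp_id (f ▷ B), comp_partialTrace, h, ← trace_smul_id, trace_id,
    MonoidalLinear.whiskerLeft_smul]
  simp

/-- The partial trace, as a linear map. -/
def partialTraceLinear (A A' B : C) : (A ⊗ B ⟶ A' ⊗ B) →ₗ[ℂ] (A ⟶ A') where
  toFun := partialTrace B
  map_add' f g := by simp [partialTrace, MonoidalPreadditive.add_whiskerRight]
  map_smul' c f := by simp [partialTrace, MonoidalLinear.smul_whiskerRight]

theorem partialTraceLinear_apply {A A' B : C} (f : A ⊗ B ⟶ A' ⊗ B) :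
    partialTraceLinear A A' B f = partialTrace B f := rfl

theorem qdim_tensor (X Y : C) : qdim (X ⊗ Y) = qdim X * qdim Y := by
  rw [← trace_id]
  change unitScalar _ = _
  rw [rightTrace_tensor, ← id_whiskerRight, partialTrace_whiskerRight]
  change trace X _ = _
  rw [map_smul, trace_id, smul_eq_mul, mul_comm]

theorem qdim_unit : qdim (𝟙_ C) = 1 := by
  have h := qdim_tensor (𝟙_ C) (𝟙_ C)
  rw [qdim_congr (λ_ (𝟙_ C))] at h
  exact (mul_eq_left₀ (qdim_ne_zero (𝟙_ C))).mp h.symm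

/-- Rotating the pair `coevPiv X`, `ε_ X Xᘁ`, whose composite has trace `dim X`, produces the
identity of `X*`. -/
theorem qdim_rightDual [SphericalCategory C] (X : C) : qdim Xᘁ = qdim X := by
  have h := rightTrace_rotate (coevPiv X) (ε_ X Xᘁ)
  have h1 (X : C) : coevPiv X ≫ (ε_ X Xᘁ) = qdim X • 𝟙 (𝟙_ C) := by
    rw [← trace_id, trace_smul_id, ← SphericalCategory.trace_eq, leftTrace]
    simp
  have h2 : rotateSplitting Xᘁ X (𝟙_ C) (coevPiv X) ≫ rotateFusion (ε_ X Xᘁ) = 𝟙 Xᘁ := by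
    have h3 := h1 (𝟙_ C)
    rw [qdim_unit, one_smul] at h3
    rw [rotateSplitting_apply, rotateFusion_eq]
    have h4 := coevPiv_whiskerRight_comp X
    rw [reassoc_of% h4, ExactPairing.coevaluation_evaluation]
    have key {V : C} (c : 𝟙_ C ⟶ V ⊗ 𝟙_ C) (e : V ⊗ 𝟙_ C ⟶ 𝟙_ C) (hc : c ≫ e = 𝟙 _) :
        ((λ_ Xᘁ).inv ≫ c ▷ Xᘁ ≫ (α_ V (𝟙_ C) Xᘁ).hom ≫
          V ◁ ((λ_ Xᘁ).hom ≫ (ρ_ Xᘁ).inv ≫ (ρ_ Xᘁ).hom)) ≫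
          V ◁ ((ρ_ Xᘁ).inv ≫ (ρ_ Xᘁ).hom ≫ (λ_ Xᘁ).inv) ≫
          (α_ V (𝟙_ C) Xᘁ).inv ≫ e ▷ Xᘁ ≫ (λ_ Xᘁ).hom = 𝟙 Xᘁ := by
      calc
        _ = 𝟙 _ ⊗≫ (c ≫ e) ▷ (Xᘁ : C) ⊗≫ 𝟙 _ := by monoidal
        _ = _ := by rw [hc]; monoidal
    exact key _ _ h3
  rw [h2, h1] at h
  have h5 := congrArg unitScalar h
  change trace Xᘁ _ = trace (𝟙_ C) _ at h5
  rw [map_smul, trace_id, trace_id, qdim_unit, smul_eq_mul, mul_one] at h5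
  exact h5

/-- A family `q` spanning `S ⟶ W`, with a family `p` in `W ⟶ S` which is dual to it for the trace
pairing. -/
structure IsTraceDual {W S : C} {ι : Type*} [DecidableEq ι] (p : ι → (W ⟶ S))
    (q : ι → (S ⟶ W)) : Prop where
  trace_comp : ∀ i j, trace S (q i ≫ p j) = if i = j then 1 else 0
  span_eq_top : Submodule.span ℂ (Set.range q) = ⊤

theorem exists_trace_comp_ne_zero {W S : C} (q : S ⟶ W) (hq : q ≠ 0) :
    ∃ p : W ⟶ S, trace S (q ≫ p) ≠ 0 := by
  obtain ⟨T, hT, r, hr⟩ : ∃ (T : C) (_ : Simple T) (r : T ⟶ S), r ≫ q ≠ 0 := by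
    by_contra! h
    exact hq (eq_zero_of_simple_comp_eq_zero _ fun S hS r => h S hS r)
  obtain ⟨p, hp⟩ := exists_retraction_of_simple _ hr
  refine ⟨p ≫ r, ?_⟩
  rw [← Category.assoc, trace_comm, ← Category.assoc, hp]
  exact qdim_ne_zero T

/-- The trace pairing has no kernel in `Hom(S, W)`, so in finite dimensions every functional on
`Hom(S, W)`, in particular a coordinate, comes from `Hom(W, S)`. -/
theorem exists_isTraceDual (W S : C) :
    ∃ (n : ℕ) (p : Fin n → (W ⟶ S)) (q : Fin n → (S ⟶ W)), IsTraceDual p q := by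
  let b := Module.finBasis ℂ (S ⟶ W)
  let β : (W ⟶ S) →ₗ[ℂ] Module.Dual ℂ (S ⟶ W) :=
    LinearMap.mk₂ ℂ (fun p q => trace S (q ≫ p)) (by simp) (by simp) (by simp) (by simp)
  have hβ : Function.Injective β.flip := by
    rw [injective_iff_map_eq_zero]
    intro q hq
    by_contra hne
    obtain ⟨p, hp⟩ := exists_trace_comp_ne_zero q hne
    exact hp (LinearMap.congr_fun hq p)
  have hβ' : Function.Surjective β := LinearMap.flip_injective_iff₁.mp hβ
  choose p hp using fun j => hβ' (b.coord j)
  refine ⟨_, p, b, fun i j => ?_, b.span_eq⟩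
  change β (p j) (b i) = _
  rw [hp, Module.Basis.coord_apply, Module.Basis.repr_self, Finsupp.single_apply]

/-- Completeness: the identity is resolved by trace-dual families through representatives of the
simple objects. -/
theorem sum_comp_eq_id_of_isTraceDual {J : Type*} {s : Finset J} {S : J → C}
    (hS : ∀ j ∈ s, Simple (S j)) (hne : ∀ i ∈ s, ∀ j ∈ s, Nonempty (S i ≅ S j) → i = j)
    (hex : ∀ X : C, Simple X → ∃ j ∈ s, Nonempty (X ≅ S j)) {W : C} {n : J → ℕ}
    (p : ∀ j, Fin (n j) → (W ⟶ S j)) (q : ∀ j, Fin (n j) → (S j ⟶ W))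
    (h : ∀ j, IsTraceDual (p j) (q j)) :
    ∑ j ∈ s, ∑ i, qdim (S j) • (p j i ≫ q j i) = 𝟙 W := by
  rw [← sub_eq_zero]
  apply eq_zero_of_simple_comp_eq_zero
  intro X hX r
  obtain ⟨k, hk, ⟨e⟩⟩ := hex X hX
  have := hS k hk
  rw [← cancel_epi e.inv, comp_zero, ← Category.assoc]
  generalize e.inv ≫ r = r'
  -- It suffices to test on the spanning family `q k`. There `q ≫ p` is `1 / dim` times the identity
  -- for matching indices, which the weight `qdim` cancels, and zero otherwise.
  have hr' : r' ∈ Submodule.span ℂ (Set.range (q k)) := by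
    rw [(h k).span_eq_top]; trivial
  induction hr' using Submodule.span_induction with
  | zero => simp
  | add x y _ _ hx hy => rw [Preadditive.add_comp, hx, hy, add_zero]
  | smul c x _ hx => rw [Linear.smul_comp, hx, smul_zero]
  | mem x hx =>
    obtain ⟨l, rfl⟩ := hx
    rw [Preadditive.comp_sub, Category.comp_id, sub_eq_zero, Preadditive.comp_sum,
      Finset.sum_eq_single k, Preadditive.comp_sum, Finset.sum_eq_single l]
    · rw [Linear.comp_smul, ← Category.assoc, eq_smul_id_of_simple (q k l ≫ p k l),
        (h k).trace_comp, if_pos rfl, Linear.smul_comp, Category.id_comp, smul_smul,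
        mul_one_div_cancel (qdim_ne_zero (S k)), one_smul]
    · intro l' _ hl'
      rw [Linear.comp_smul, ← Category.assoc, eq_smul_id_of_simple (q k l ≫ p k l'),
        (h k).trace_comp, if_neg hl'.symm]
      simp
    · simp
    · intro j hj hjk
      have := hS j hj
      rw [Preadditive.comp_sum]
      refine Finset.sum_eq_zero fun i _ => ?_
      have : q k l ≫ p j i = 0 := by
        by_contra hz
        have := isIso_of_hom_simple hz
        exact hjk (hne k hk j hj ⟨asIso (q k l ≫ p j i)⟩).symm
      rw [Linear.comp_smul, reassoc_of% this, zero_comp, smul_zero]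
    · exact fun hk' => absurd hk hk'

theorem IsTraceDual.rotate [SphericalCategory C] {Y B Z : C} {ι : Type*} [DecidableEq ι]
    {p : ι → (Y ⊗ B ⟶ Z)} {q : ι → (Z ⟶ Y ⊗ B)} (h : IsTraceDual p q) :
    IsTraceDual (fun i => rotateFusion (p i)) (fun i => rotateSplitting Y B Z (q i)) where
  trace_comp i j := by
    rw [← h.trace_comp i j]
    exact congrArg unitScalar (rightTrace_rotate _ _)
  span_eq_top := by
    let L : (Z ⟶ Y ⊗ B) →ₗ[ℂ] (Bᘁ ⟶ Zᘁ ⊗ Y) :=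
      { toFun := rotateSplitting Y B Z
        map_add' := fun f g => by
          simp [rotateSplitting_apply, MonoidalPreadditive.add_whiskerRight]
        map_smul' := fun c f => by
          simp [rotateSplitting_apply, MonoidalLinear.smul_whiskerRight] }
    have hL : Set.range (fun i => rotateSplitting Y B Z (q i)) = L '' Set.range q := by
      rw [← Set.range_comp]; rfl
    rw [hL, Submodule.span_image, h.span_eq_top, Submodule.map_top, LinearMap.range_eq_top]
    exact (rotateSplitting Y B Z).surjective

/-- Bases of the multiplicity spaces of `Z` in `Y ⊗ B` which resolve the identity of `Y ⊗ B` and,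
after rotation, that of `Z* ⊗ Y`. -/
theorem exists_fusion_bases [SphericalCategory C] {O : Finset C} (hO : IsSimpleReps O) (Y : C) :
    ∃ (n : C → C → ℕ) (p : ∀ B Z, Fin (n B Z) → (Y ⊗ B ⟶ Z))
      (q : ∀ B Z, Fin (n B Z) → (Z ⟶ Y ⊗ B)),
      (∀ B Z i, trace Z (q B Z i ≫ p B Z i) = 1) ∧
      (∀ B, ∑ Z ∈ O, ∑ i, qdim Z • (p B Z i ≫ q B Z i) = 𝟙 (Y ⊗ B)) ∧
      (∀ Z, ∑ B ∈ O, ∑ i, qdim B • (rotateFusion (p B Z i) ≫ rotateSplitting Y B Z (q B Z i)) =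
        𝟙 (Zᘁ ⊗ Y)) := by
  choose n p q h using fun B Z => exists_isTraceDual (Y ⊗ B) Z
  obtain ⟨hS, hne, hex⟩ := hO
  refine ⟨n, p, q, fun B Z i => by rw [(h B Z).trace_comp, if_pos rfl], fun B =>
    sum_comp_eq_id_of_isTraceDual (S := fun Z : C => Z) hS hne hex (p B) (q B) (h B), fun Z => ?_⟩
  -- The duals `B*` also represent all simple objects, since `B ≅ B**`. Indexing them by `B` lets
  -- the rotated families keep the index sets of the original ones.
  have := sum_comp_eq_id_of_isTraceDual (s := O) (S := fun B : C => (Bᘁ : C))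
    (fun B hB => have := hS B hB; simple_rightDual B)
    (fun B hB B' hB' ⟨e⟩ => (hne B hB B' hB'
      ⟨piv B ≪≫ (rightDualMapIso e).symm ≪≫ (piv B').symm⟩))
    (fun X hX => by
      obtain ⟨B, hB, ⟨e⟩⟩ := hex Xᘁ (simple_rightDual X)
      exact ⟨B, hB, ⟨piv X ≪≫ (rightDualMapIso e).symm⟩⟩)
    (fun B i => rotateFusion (p B Z i)) (fun B i => rotateSplitting Y B Z (q B Z i))
    (fun B => (h B Z).rotate)
  simpa only [qdim_rightDual] using this

end Pivotal
end Semisimple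

/-! ### Reality of dimensions -/

section Dimension

variable {C : Type u} [Category.{v} C] [Abelian C] [Linear ℂ C] [MonoidalCategory C]
  [MonoidalPreadditive C] [MonoidalLinear ℂ C] [RigidCategory C] [FusionCategory C]
  [PivotalCategory C] [SphericalCategory C]

/-- The dimensions of objects of a spherical fusion category are real. -/
theorem conj_qdim (Y : C) : (starRingEnd ℂ) (qdim Y) = qdim Y := by
  obtain ⟨O, hO⟩ := FusionCategory.finite_simples (C := C)
  obtain ⟨n, p, q, h1, h2, h3⟩ := exists_fusion_bases hO Y
  -- Traces of the two resolutions of the identity: the vector of dimensions is an eigenvector, with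
  -- eigenvalue `dim Y`, of the fusion matrix of `Y` (`hI`) and of its transpose (`hII`).
  have hI (B : C) : ∑ Z ∈ O, (n B Z : ℂ) * qdim Z = qdim Y * qdim B := by
    rw [← qdim_tensor, ← trace_id, ← h2 B, map_sum]
    refine Finset.sum_congr rfl fun Z _ => ?_
    rw [map_sum, Finset.sum_congr rfl (g := fun _ => qdim Z)]
    · simp
    · intro i _
      rw [map_smul, trace_comm, h1, smul_eq_mul, mul_one]
  have hII (Z : C) : ∑ B ∈ O, (n B Z : ℂ) * qdim B = qdim Z * qdim Y := by
    rw [← qdim_rightDual Z, ← qdim_tensor, ← trace_id, ← h3 Z, map_sum]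
    refine Finset.sum_congr rfl fun B _ => ?_
    rw [map_sum, Finset.sum_congr rfl (g := fun _ => qdim B)]
    · simp
    · intro i _
      have h4 : trace Bᘁ (rotateSplitting Y B Z (q B Z i) ≫ rotateFusion (p B Z i)) = 1 :=
        (congrArg unitScalar (rightTrace_rotate _ _)).trans (h1 B Z i)
      rw [map_smul, trace_comm, h4, smul_eq_mul, mul_one]
  have hN : ∑ B ∈ O, (starRingEnd ℂ) (qdim B) * qdim B ≠ 0 := by
    have h5 : ∑ B ∈ O, (starRingEnd ℂ) (qdim B) * qdim B =
        ((∑ B ∈ O, Complex.normSq (qdim B) : ℝ) : ℂ) := by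
      push_cast
      exact Finset.sum_congr rfl fun B _ => Complex.normSq_eq_conj_mul_self.symm
    obtain ⟨U, hU, -⟩ := hO.2.2 (𝟙_ C) FusionCategory.simple_unit
    have := hO.1 U hU
    rw [h5, Complex.ofReal_ne_zero]
    exact (Finset.sum_pos' (fun B _ => Complex.normSq_nonneg _)
      ⟨U, hU, Complex.normSq_pos.mpr (qdim_ne_zero U)⟩).ne'
  refine mul_right_cancel₀ hN ?_
  -- The matrix `n` has real entries. Evaluating its Hermitian form on the vector of dimensions from
  -- either side gives the eigenvalue `dim Y` or its conjugate.
  calc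
    _ = ∑ Z ∈ O, (starRingEnd ℂ) (qdim Z * qdim Y) * qdim Z := by
      rw [Finset.mul_sum]
      refine Finset.sum_congr rfl fun Z _ => ?_
      rw [map_mul]; ring
    _ = ∑ Z ∈ O, ∑ B ∈ O, (n B Z : ℂ) * (starRingEnd ℂ) (qdim B) * qdim Z := by
      refine Finset.sum_congr rfl fun Z _ => ?_
      rw [← hII, map_sum, Finset.sum_mul]
      refine Finset.sum_congr rfl fun B _ => ?_
      rw [map_mul, Complex.conj_natCast]
    _ = ∑ B ∈ O, (starRingEnd ℂ) (qdim B) * ∑ Z ∈ O, (n B Z : ℂ) * qdim Z := by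
      rw [Finset.sum_comm]
      refine Finset.sum_congr rfl fun B _ => ?_
      rw [Finset.mul_sum]
      refine Finset.sum_congr rfl fun Z _ => ?_
      ring
    _ = _ := by
      rw [Finset.mul_sum]
      refine Finset.sum_congr rfl fun B _ => ?_
      rw [hI]; ring

end Dimension

/-! ### Degrees of simple objects -/

namespace Grading

variable {G : Type w} [Group G] [Finite G]
variable {C : Type u} [Category.{v} C] [Abelian C] [Linear ℂ C] [MonoidalCategory C]
  [MonoidalPreadditive C] [MonoidalLinear ℂ C] [RigidCategory C] [FusionCategory C]
variable (D : Grading G C)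

theorem deg_of_retract {g : G} {S W : C} (hW : D.deg g W) (i : S ⟶ W) (p : W ⟶ S)
    (h : i ≫ p = 𝟙 S) : D.deg g S := by
  obtain ⟨Y, hY, ⟨e⟩⟩ := D.decomposition S
  have h0 (k : G) (hk : k ≠ g) : biproduct.ι Y k ≫ e.inv = 0 := by
    rw [← Category.comp_id (_ ≫ e.inv), ← h, ← Category.assoc,
      D.hom_eq_zero hk (hY k) hW ((biproduct.ι Y k ≫ e.inv) ≫ i), zero_comp]
  refine D.deg_iso (X := Y g) ⟨biproduct.ι Y g ≫ e.inv, e.hom ≫ biproduct.π Y g, by simp, ?_⟩ (hY g)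
  rw [← cancel_epi e.inv]
  ext k
  by_cases hk : k = g
  · subst hk
    simp
  · simp [h0 k hk, biproduct.ι_π_ne_assoc _ hk]

theorem deg_of_simple_hom_ne_zero {g : G} {S W : C} [Simple S] (hW : D.deg g W) (q : S ⟶ W)
    (hq : q ≠ 0) : D.deg g S := by
  obtain ⟨p, hp⟩ := exists_retraction_of_simple q hq
  exact D.deg_of_retract hW q p hp

theorem exists_deg_of_simple (S : C) [Simple S] : ∃ g, D.deg g S := by
  obtain ⟨Y, hY, ⟨e⟩⟩ := D.decomposition S
  by_contra! h
  refine id_nonzero S ?_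
  rw [← cancel_mono e.hom]
  ext k
  by_contra hne
  exact h k (D.deg_of_simple_hom_ne_zero (hY k) (e.hom ≫ biproduct.π Y k) (by simpa using hne))

end Grading

/-! ### Handle slide and dimensions of Kirby colours -/

namespace CrossedBraided

variable {G : Type w} [Group G] [Finite G]
variable {C : Type u} [Category.{v} C] [Abelian C] [Linear ℂ C] [MonoidalCategory C]
  [MonoidalPreadditive C] [MonoidalLinear ℂ C] [RigidCategory C] [FusionCategory C]
  [PivotalCategory C] [SphericalCategory C]
variable (K : CrossedBraided G C) {O : Finset C}

theorem sum_simplesOfDegree {M : Type*} [AddCommMonoid M] (g : G) (f : C → M)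
    (hf : ∀ Z ∈ O, ¬ K.deg g Z → f Z = 0) :
    ∑ Z : K.SimplesOfDegree O g, f Z.1 = ∑ Z ∈ O, f Z := by
  refine Finset.sum_of_injOn (fun Z : K.SimplesOfDegree O g => Z.1)
    (fun _ _ _ _ h => Subtype.ext h) (fun Z _ => Z.2.1) (fun Z hZ hZ' => hf Z hZ fun h => hZ' ?_)
    fun _ _ => rfl
  exact ⟨⟨Z, hZ, h⟩, Finset.mem_coe.mpr (Finset.mem_univ _), rfl⟩

/-- The handle slide: pushing a strand `Y` of degree `h` into a loop coloured by the Kirby colour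
of degree `g` gives a loop coloured by the Kirby colour of degree `h * g`. -/
theorem handle_slide (hO : IsSimpleReps O) {g h k : G} (e : h * g = k) {A A' : C}
    (φ : ∀ {W : C}, K.deg k W → (A ⊗ W ⟶ A' ⊗ W))
    (hφ : ∀ {W W' : C} (hW : K.deg k W) (hW' : K.deg k W') (f : W ⟶ W'),
      A ◁ f ≫ φ hW' = φ hW ≫ A' ◁ f) {Y : C} (hY : K.deg h Y) :
    ∑ B : K.SimplesOfDegree O g, qdim B.1 • partialTrace B.1
        ((α_ A Y B.1).hom ≫ φ (e ▸ K.deg_tensor hY B.2.2) ≫ (α_ A' Y B.1).inv) =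
      (∑ Z : K.SimplesOfDegree O k, qdim Z.1 • partialTrace Z.1 (φ Z.2.2)) ▷ Y := by
  obtain ⟨n, p, q, -, h2, h3⟩ := exists_fusion_bases hO Y
  have hl (B : K.SimplesOfDegree O g) : partialTrace B.1
        ((α_ A Y B.1).hom ≫ φ (e ▸ K.deg_tensor hY B.2.2) ≫ (α_ A' Y B.1).inv) =
      ∑ Z : K.SimplesOfDegree O k, ∑ i, qdim Z.1 • loopAlong (φ Z.2.2)
        (rotateFusion (p B.1 Z.1 i) ≫ rotateSplitting Y B.1 Z.1 (q B.1 Z.1 i)) := by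
    have hB := h2 B.1
    rw [← K.sum_simplesOfDegree k] at hB
    · have hsum : φ (e ▸ K.deg_tensor hY B.2.2) = ∑ Z : K.SimplesOfDegree O k, ∑ i,
          qdim Z.1 • (A ◁ p B.1 Z.1 i ≫ φ Z.2.2 ≫ A' ◁ q B.1 Z.1 i) := by
        rw [← Category.id_comp (φ _), ← MonoidalCategory.whiskerLeft_id, ← hB]
        simp only [whiskerLeft_sum, MonoidalLinear.whiskerLeft_smul, Preadditive.sum_comp,
          Linear.smul_comp]
        refine Finset.sum_congr rfl fun Z _ => Finset.sum_congr rfl fun i _ => ?_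
        rw [MonoidalCategory.whiskerLeft_comp, Category.assoc, hφ Z.2.2]
      rw [hsum, ← partialTraceLinear_apply]
      simp only [Preadditive.sum_comp, Preadditive.comp_sum, Linear.smul_comp, Linear.comp_smul,
        map_sum, map_smul, partialTraceLinear_apply]
      refine Finset.sum_congr rfl fun Z _ => Finset.sum_congr rfl fun i _ => ?_
      rw [← partialTrace_fusion_splitting, Category.assoc, Category.assoc]
    · intro Z hZ hZk
      refine Finset.sum_eq_zero fun i _ => ?_
      have := hO.1 Z hZ
      have : q B.1 Z i = 0 := by
        by_contra hne
        exact hZk (K.deg_of_simple_hom_ne_zero (e ▸ K.deg_tensor hY B.2.2) _ hne)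
      rw [this, comp_zero, smul_zero]
  have hr (Z : K.SimplesOfDegree O k) : partialTrace Z.1 (φ Z.2.2) ▷ Y =
      ∑ B : K.SimplesOfDegree O g, ∑ i, qdim B.1 • loopAlong (φ Z.2.2)
        (rotateFusion (p B.1 Z.1 i) ≫ rotateSplitting Y B.1 Z.1 (q B.1 Z.1 i)) := by
    have hZ := h3 Z.1
    rw [← K.sum_simplesOfDegree g] at hZ
    · rw [← loopAlong_id, ← hZ]
      simp [loopAlong, monoidalComp, whiskerLeft_sum, Preadditive.sum_comp,
        Preadditive.comp_sum]
    · intro B hB hBg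
      refine Finset.sum_eq_zero fun i _ => ?_
      have := hO.1 B hB
      obtain ⟨g', hg'⟩ := K.exists_deg_of_simple B
      have : q B Z.1 i = 0 := by
        refine K.hom_eq_zero ?_ Z.2.2 (K.deg_tensor hY hg') _
        rintro rfl
        exact hBg (mul_left_cancel e ▸ hg')
      rw [this]
      simp [rotateSplitting_apply]
  simp only [hl, sum_whiskerRight, MonoidalLinear.smul_whiskerRight, hr,
    Finset.smul_sum]
  rw [Finset.sum_comm]
  refine Finset.sum_congr rfl fun Z _ => Finset.sum_congr rfl fun B _ =>
    Finset.sum_congr rfl fun i _ => ?_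
  rw [smul_smul, smul_smul, mul_comm]

theorem kirbyColour_dim (g : G) :
    (K.kirbyColour O g).dim = ∑ X : K.SimplesOfDegree O g, qdim X.1 * qdim X.1 := rfl

/-- The handle slide for identity operators compares two multiples of the identity of `𝟙 ⊗ Y`; the
scalars agree because `Y` is nonzero. -/
theorem dim_kirbyColour_eq (hO : IsSimpleReps O) {g h k : G} (e : h * g = k) {Y : C}
    (hY : K.deg h Y) (hY0 : ¬ IsZero Y) : (K.kirbyColour O g).dim = (K.kirbyColour O k).dim := by
  have hs := K.handle_slide hO e (A := 𝟙_ C) (A' := 𝟙_ C) (fun {W} _ => 𝟙 (𝟙_ C ⊗ W))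
    (fun _ _ f => by simp) hY
  have hid (A B : C) : partialTrace B (𝟙 (A ⊗ B)) = qdim B • 𝟙 A := by
    rw [← id_whiskerRight, partialTrace_whiskerRight]
  simp only [Category.id_comp, Iso.hom_inv_id, hid, smul_smul, ← Finset.sum_smul,
    MonoidalLinear.smul_whiskerRight, id_whiskerRight] at hs
  rw [← kirbyColour_dim, ← kirbyColour_dim, ← sub_eq_zero, ← sub_smul] at hs
  refine sub_eq_zero.mp ((smul_eq_zero.mp hs).resolve_right fun h0 => hY0 ?_)
  exact ((IsZero.iff_id_eq_zero _).mpr h0).of_iso (λ_ Y).symm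

theorem dim_kirbyColour_one_ne_zero (hO : IsSimpleReps O) : (K.kirbyColour O 1).dim ≠ 0 := by
  have hre (X : C) : ((qdim X).re : ℂ) = qdim X := Complex.conj_eq_iff_re.mp (conj_qdim X)
  have h : (K.kirbyColour O 1).dim =
      ((∑ X : K.SimplesOfDegree O 1, (qdim X.1).re * (qdim X.1).re : ℝ) : ℂ) := by
    rw [kirbyColour_dim]
    push_cast
    simp only [hre]
  obtain ⟨U, hU, ⟨e⟩⟩ := hO.2.2 (𝟙_ C) FusionCategory.simple_unit
  have := hO.1 U hU
  rw [h, Complex.ofReal_ne_zero]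
  refine (Finset.sum_pos' (fun X _ => mul_self_nonneg _)
    ⟨⟨U, hU, K.deg_iso e K.deg_unit⟩, Finset.mem_univ _, mul_self_pos.mpr ?_⟩).ne'
  intro h0
  apply qdim_ne_zero U
  rw [← hre, h0, Complex.ofReal_zero]

end CrossedBraided

/-! ### Monodromy and encirclings -/

section MonoidalCategory

variable {C : Type u} [Category.{v} C] [MonoidalCategory C]

/-- The string diagram manipulation behind the monodromy around a tensor product. -/
theorem double_crossing_tensor {A Y B Y' B' P Q R : C} (c₁ : A ⊗ Y ⟶ Y' ⊗ A)
    (c₂ : A ⊗ B ⟶ B' ⊗ A) (c₃ : B' ⊗ A ⟶ P ⊗ B') (c₄ : Y' ⊗ P ⟶ Q ⊗ Y') (m : Q ⟶ R)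
    (s : Y' ⟶ Y) (t : B' ⟶ B) :
    c₁ ▷ B ≫ (α_ Y' A B).hom ≫ Y' ◁ c₂ ≫ (α_ Y' B' A).inv ≫ (α_ Y' B' A).hom ≫
        Y' ◁ c₃ ≫ (α_ Y' P B').inv ≫ c₄ ▷ B' ≫ (α_ Q Y' B').hom ≫ m ▷ (Y' ⊗ B') ≫
        R ◁ (Y' ◁ t ≫ s ▷ B) ≫ (α_ R Y B).inv =
      c₁ ▷ B ≫ (α_ Y' A B).hom ≫ Y' ◁ (c₂ ≫ c₃ ≫ P ◁ t) ≫ (α_ Y' P B).inv ≫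
        (c₄ ≫ Q ◁ s ≫ m ▷ Y) ▷ B := by
  calc
    _ = c₁ ▷ B ⊗≫ Y' ◁ c₂ ⊗≫ Y' ◁ c₃ ⊗≫ c₄ ▷ B' ⊗≫
        (m ▷ (Y' ⊗ B') ≫ R ◁ (Y' ◁ t ≫ s ▷ B)) ⊗≫ 𝟙 _ := by monoidal
    _ = c₁ ▷ B ⊗≫ Y' ◁ c₂ ⊗≫ Y' ◁ c₃ ⊗≫ (c₄ ▷ B' ≫ (Q ⊗ Y') ◁ t) ⊗≫
        Q ◁ s ▷ B ⊗≫ m ▷ (Y ⊗ B) ⊗≫ 𝟙 _ := by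
      rw [← whisker_exchange]
      monoidal
    _ = _ := by
      rw [← whisker_exchange]
      monoidal

end MonoidalCategory

section PartialTrace

variable {C : Type u} [Category.{v} C] [MonoidalCategory C] [RigidCategory C] [PivotalCategory C]

theorem partialTrace_whiskerLeft (X : C) {A A' B : C} (f : A ⊗ B ⟶ A' ⊗ B) :
    partialTrace B ((α_ X A B).hom ≫ X ◁ f ≫ (α_ X A' B).inv) = X ◁ partialTrace B f := by
  rw [partialTrace, partialTrace]
  monoidal

end PartialTrace

namespace CrossedBraided

variable {G : Type w} [Group G] [Finite G]
variable {C : Type u} [Category.{v} C] [Abelian C] [Linear ℂ C] [MonoidalCategory C]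
  [MonoidalPreadditive C] [MonoidalLinear ℂ C] [RigidCategory C] [FusionCategory C]
  [PivotalCategory C] [SphericalCategory C]
variable (K : CrossedBraided G C) {O : Finset C}

/-- The double braiding with the coherence `ᵉB ≅ B` applied to the second factor; its partial trace
is the encircling. -/
def monodromy {g : G} {A B : C} (hA : K.deg 1 A) (hB : K.deg g B) :
    A ⊗ B ⟶ (K.act g).obj A ⊗ B :=
  K.doubleBraiding hA hB ≫ (K.act g).obj A ◁ K.oneIso.hom.app B

theorem encircling_eq {g : G} {A B : C} (hA : K.deg 1 A) (hB : K.deg g B) :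
    K.encircling hA hB = partialTrace B (K.monodromy hA hB) := rfl

theorem monodromy_naturality_left {g : G} {A A' B : C} (hA : K.deg 1 A) (hA' : K.deg 1 A')
    (hB : K.deg g B) (f : A ⟶ A') :
    f ▷ B ≫ K.monodromy hA' hB = K.monodromy hA hB ≫ (K.act g).map f ▷ B := by
  rw [monodromy, monodromy, doubleBraiding, doubleBraiding, Category.assoc, Category.assoc,
    Category.assoc, ← Category.assoc (f ▷ B), K.naturality_left hA hA' f, Category.assoc,
    ← Category.assoc (_ ◁ f), K.naturality_right, Category.assoc, whisker_exchange]

theorem monodromy_naturality_right {g : G} {A B B' : C} (hA : K.deg 1 A) (hB : K.deg g B)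
    (hB' : K.deg g B') (f : B ⟶ B') :
    A ◁ f ≫ K.monodromy hA hB' = K.monodromy hA hB ≫ (K.act g).obj A ◁ f := by
  have h : (K.act 1).map f ≫ K.oneIso.hom.app B' = K.oneIso.hom.app B ≫ f :=
    K.oneIso.hom.naturality f
  rw [monodromy, monodromy, doubleBraiding, doubleBraiding, Category.assoc, Category.assoc,
    Category.assoc, ← Category.assoc (A ◁ f), K.naturality_right, Category.assoc,
    ← Category.assoc ((K.act 1).map f ▷ A), K.naturality_left (K.deg_one_act hB)
    (K.deg_one_act hB'), Category.assoc, ← MonoidalCategory.whiskerLeft_comp, h,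
    MonoidalCategory.whiskerLeft_comp]

theorem encircling_naturality {g : G} {A A' B : C} (hA : K.deg 1 A) (hA' : K.deg 1 A')
    (hB : K.deg g B) (f : A ⟶ A') :
    f ≫ K.encircling hA' hB = K.encircling hA hB ≫ (K.act g).map f := by
  rw [encircling_eq, encircling_eq, ← comp_partialTrace, ← partialTrace_comp,
    K.monodromy_naturality_left hA hA']

theorem oneIso_tensor (Y B : C) :
    Functor.LaxMonoidal.μ (K.act 1) Y B ≫ K.oneIso.hom.app (Y ⊗ B) =
      (K.oneIso.hom.app Y ⊗ₘ K.oneIso.hom.app B) := by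
  have := K.oneIso_monoidal.tensor Y B
  simpa using this

/-- The monodromy of `A` around a tensor product `Y ⊗ B`. -/
theorem monodromy_tensor {g h k : G} (e : h * g = k) {A Y B : C} (hA : K.deg 1 A)
    (hY : K.deg h Y) (hB : K.deg g B) (hYB : K.deg k (Y ⊗ B)) :
    (α_ A Y B).hom ≫ K.monodromy hA hYB ≫ (α_ _ Y B).inv =
      (K.c hA Y).hom ▷ B ≫
        ((α_ _ A B).hom ≫ (K.act 1).obj Y ◁ K.monodromy hA hB ≫ (α_ _ _ B).inv) ≫
        ((K.c (K.deg_one_act hY) ((K.act g).obj A)).hom ≫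
          ((K.mulIso e).hom.app A ⊗ₘ K.oneIso.hom.app Y)) ▷ B := by
  subst e
  have h1 := K.hexagon_right hA Y B
  have hYB' : K.deg (h * g) ((K.act 1).obj Y ⊗ (K.act 1).obj B) :=
    K.deg_tensor (K.deg_one_act hY) (K.deg_one_act hB)
  have h2 := K.naturality_left (K.deg_one_act hYB) hYB' (Functor.OplaxMonoidal.δ (K.act 1) Y B) A
  have h3 := K.hexagon_left (K.deg_one_act hY) (K.deg_one_act hB) A
  -- The second crossing involves `ᵉ(Y ⊗ B)`; it is rewritten through `ᵉY ⊗ ᵉB` so that the second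
  -- hexagon applies.
  have h4 : (K.c (K.deg_one_act hYB) A).hom =
      Functor.OplaxMonoidal.δ (K.act 1) Y B ▷ A ≫ (K.c hYB' A).hom ≫
        (K.act (h * g)).obj A ◁ Functor.LaxMonoidal.μ (K.act 1) Y B := by
    rw [reassoc_of% h2, ← MonoidalCategory.whiskerLeft_comp]
    simp
  rw [monodromy, doubleBraiding, h4, monodromy, doubleBraiding]
  simp only [Category.assoc]
  rw [reassoc_of% h1, h3, ← MonoidalCategory.whiskerLeft_comp_assoc, oneIso_tensor, tensorHom_def',
    tensorHom_def']
  rw [Iso.hom_inv_id_assoc]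
  simp only [Category.assoc]
  exact double_crossing_tensor (C := C) _ _ _ _ _ _ _

/-- `A` crosses `Y`, is encircled by `B`, and crosses back over `Y`. Naturality of the crossing
pulls the encircling in front of it. -/
theorem partialTrace_monodromy_tensor {g h k : G} (e : h * g = k) {A Y B : C} (hA : K.deg 1 A)
    (hY : K.deg h Y) (hB : K.deg g B) (hYB : K.deg k (Y ⊗ B)) :
    partialTrace B ((α_ A Y B).hom ≫ K.monodromy hA hYB ≫ (α_ _ Y B).inv) =
      K.encircling hA hB ▷ Y ≫ K.monodromy (K.deg_act_one g hA) hY ≫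
        (K.mulIso e).hom.app A ▷ Y := by
  rw [K.monodromy_tensor e hA hY hB, comp_partialTrace, partialTrace_comp,
    partialTrace_whiskerLeft, ← encircling_eq, ← Category.assoc, ← K.naturality_left hA
    (K.deg_act_one g hA), monodromy, doubleBraiding, tensorHom_def']
  simp only [Category.assoc]
  rfl

theorem kirbyColour_encircling (g : G) {A : C} (hA : K.deg 1 A) :
    (K.kirbyColour O g).encircling hA =
      ∑ X : K.SimplesOfDegree O g, qdim X.1 • K.encircling hA X.2.2 := rfl

theorem kirbyColour_encircling_naturality (g : G) {A A' : C} (hA : K.deg 1 A) (hA' : K.deg 1 A')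
    (f : A ⟶ A') :
    f ≫ (K.kirbyColour O g).encircling hA' =
      (K.kirbyColour O g).encircling hA ≫ (K.act g).map f := by
  simp only [kirbyColour_encircling, Preadditive.comp_sum, Preadditive.sum_comp, Linear.comp_smul,
    Linear.smul_comp, K.encircling_naturality hA hA']

/-- The handle slide for encirclings. -/
theorem kirbyColour_encircling_slide (hO : IsSimpleReps O) {g h k : G} (e : h * g = k) {A Y : C}
    (hA : K.deg 1 A) (hY : K.deg h Y) :
    (K.kirbyColour O g).encircling hA ▷ Y ≫ K.monodromy (K.deg_act_one g hA) hY ≫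
        (K.mulIso e).hom.app A ▷ Y =
      (K.kirbyColour O k).encircling hA ▷ Y := by
  rw [kirbyColour_encircling, kirbyColour_encircling]
  refine Eq.trans ?_ (K.handle_slide hO e (fun hW => K.monodromy hA hW)
    (fun hW hW' f => K.monodromy_naturality_right hA hW hW' f) hY)
  simp only [sum_whiskerRight, MonoidalLinear.smul_whiskerRight, Preadditive.sum_comp,
    Linear.smul_comp]
  exact Finset.sum_congr rfl fun B _ => by rw [K.partialTrace_monodromy_tensor e hA hY B.2.2]

theorem kirbyColour_encircling_comp_encircling (hO : IsSimpleReps O) {g h k : G} (e : h * g = k)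
    {A Y : C} (hA : K.deg 1 A) (hY : K.deg h Y) :
    (K.kirbyColour O g).encircling hA ≫ K.encircling (K.deg_act_one g hA) hY ≫
        (K.mulIso e).hom.app A =
      qdim Y • (K.kirbyColour O k).encircling hA := by
  rw [← partialTrace_whiskerRight, ← K.kirbyColour_encircling_slide hO e hA hY,
    comp_partialTrace, partialTrace_comp, encircling_eq]

theorem kirbyColour_encircling_comp (hO : IsSimpleReps O) {g h k : G} (e : h * g = k)
    {A : C} (hA : K.deg 1 A) :
    (K.kirbyColour O g).encircling hA ≫ (K.kirbyColour O h).encircling (K.deg_act_one g hA) ≫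
        (K.mulIso e).hom.app A =
      (K.kirbyColour O h).dim • (K.kirbyColour O k).encircling hA := by
  rw [K.kirbyColour_encircling h, kirbyColour_dim, Preadditive.sum_comp, Preadditive.comp_sum,
    Finset.sum_smul]
  refine Finset.sum_congr rfl fun Y _ => ?_
  rw [Linear.smul_comp, Linear.comp_smul,
    K.kirbyColour_encircling_comp_encircling hO e hA Y.2.2, smul_smul]

/-! ### Encirclings by the Kirby colour of trivial degree -/

variable (O) in
/-- The endomorphism of `A` given by encircling with the Kirby colour of trivial degree. -/
def kirbyEnd {A : C} (hA : K.deg 1 A) : A ⟶ A :=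
  (K.kirbyColour O 1).encircling hA ≫ K.oneIso.hom.app A

theorem kirbyEnd_naturality {A A' : C} (hA : K.deg 1 A) (hA' : K.deg 1 A') (f : A ⟶ A') :
    f ≫ K.kirbyEnd O hA' = K.kirbyEnd O hA ≫ f := by
  have h : (K.act 1).map f ≫ K.oneIso.hom.app A' = K.oneIso.hom.app A ≫ f :=
    K.oneIso.hom.naturality f
  rw [kirbyEnd, kirbyEnd, ← Category.assoc, K.kirbyColour_encircling_naturality 1 hA hA',
    Category.assoc, h, Category.assoc]

theorem isTransparent_iff {A : C} (hA : K.deg 1 A) :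
    K.IsTransparent A ↔ ∀ (B : C) (hB : K.deg 1 B),
      K.monodromy hA hB ≫ K.oneIso.hom.app A ▷ B = 𝟙 (A ⊗ B) := by
  simp only [IsTransparent, hA, exists_true_left, monodromy, Category.assoc, tensorHom_def']
  exact Iff.rfl

theorem kirbyEnd_slide (hO : IsSimpleReps O) {A Y : C} (hA : K.deg 1 A) (hY : K.deg 1 Y) :
    K.kirbyEnd O hA ▷ Y ≫ K.monodromy hA hY ≫ K.oneIso.hom.app A ▷ Y =
      K.kirbyEnd O hA ▷ Y := by
  have h := K.kirbyColour_encircling_slide hO (_root_.mul_one 1) hA hY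
  rw [K.mul_one, ← K.monodromy_naturality_left _ hA] at h
  rw [kirbyEnd, comp_whiskerRight, Category.assoc]
  have h' := congrArg (· ≫ K.oneIso.hom.app A ▷ Y) h
  simpa only [Category.assoc] using h'

theorem encircling_comp_oneIso_of_isTransparent {A B : C} (hA : K.deg 1 A) (hB : K.deg 1 B)
    (h : K.IsTransparent A) : K.encircling hA hB ≫ K.oneIso.hom.app A = qdim B • 𝟙 A := by
  rw [encircling_eq, ← partialTrace_comp, (K.isTransparent_iff hA).mp h B hB,
    ← partialTrace_whiskerRight, id_whiskerRight]

theorem kirbyEnd_of_isTransparent {A : C} (hA : K.deg 1 A) (h : K.IsTransparent A) :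
    K.kirbyEnd O hA = (K.kirbyColour O 1).dim • 𝟙 A := by
  rw [kirbyEnd, kirbyColour_encircling, kirbyColour_dim, Preadditive.sum_comp, Finset.sum_smul]
  refine Finset.sum_congr rfl fun B _ => ?_
  rw [Linear.smul_comp, K.encircling_comp_oneIso_of_isTransparent hA B.2.2 h, smul_smul]

/-- After `kirbyEnd` the monodromy around any `B` of trivial degree is invisible by
`kirbyEnd_slide`, so a further loop of `B` contributes only `dim B`. -/
theorem kirbyEnd_comp_kirbyEnd (hO : IsSimpleReps O) {A : C} (hA : K.deg 1 A) :
    K.kirbyEnd O hA ≫ K.kirbyEnd O hA = (K.kirbyColour O 1).dim • K.kirbyEnd O hA := by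
  have h (B : K.SimplesOfDegree O 1) :
      K.kirbyEnd O hA ≫ K.encircling hA B.2.2 ≫ K.oneIso.hom.app A =
        qdim B.1 • K.kirbyEnd O hA := by
    rw [encircling_eq, ← partialTrace_comp]
    exact (comp_partialTrace _ _ _).symm.trans
      ((congrArg _ (K.kirbyEnd_slide hO hA B.2.2)).trans (partialTrace_whiskerRight _ _))
  conv_lhs => enter [2]; rw [kirbyEnd, kirbyColour_encircling]
  rw [kirbyColour_dim, Preadditive.sum_comp, Preadditive.comp_sum, Finset.sum_smul]
  refine Finset.sum_congr rfl fun B _ => ?_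
  rw [Linear.smul_comp, Linear.comp_smul, h, smul_smul]

end CrossedBraided

/-! ### The transparent projection and invertibility of encirclings -/

namespace CrossedBraided

variable {G : Type w} [Group G] [Finite G]
variable {C : Type u} [Category.{v} C] [Abelian C] [Linear ℂ C] [MonoidalCategory C]
  [MonoidalPreadditive C] [MonoidalLinear ℂ C] [RigidCategory C] [FusionCategory C]
  [PivotalCategory C] [SphericalCategory C]
variable (K : CrossedBraided G C) {O : Finset C}

/-- The action of `g` is an autoequivalence, with inverse the action of `g⁻¹`. -/
def actEquivalence (g : G) : C ≌ C :=
  CategoryTheory.Equivalence.mk (K.act g) (K.act g⁻¹)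
    (K.oneIso.symm ≪≫ (K.mulIso (inv_mul_cancel g)).symm)
    (K.mulIso (mul_inv_cancel g) ≪≫ K.oneIso)

theorem simple_act (g : G) (X : C) [Simple X] : Simple ((K.act g).obj X) :=
  have : (K.act g).IsEquivalence := (K.actEquivalence g).isEquivalence_functor
  simple_obj (K.act g) X

/-- The normalised encircling by the Kirby colour of trivial degree is the projection onto the
maximal transparent subobject. -/
theorem isTransparentProjection_kirbyEnd (hO : IsSimpleReps O) {A : C} (hA : K.deg 1 A) :
    K.IsTransparentProjection ((K.kirbyColour O 1).dim⁻¹ • K.kirbyEnd O hA) := by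
  have hD := K.dim_kirbyColour_one_ne_zero hO
  have hidem : ((K.kirbyColour O 1).dim⁻¹ • K.kirbyEnd O hA) ≫
      ((K.kirbyColour O 1).dim⁻¹ • K.kirbyEnd O hA) =
      (K.kirbyColour O 1).dim⁻¹ • K.kirbyEnd O hA := by
    rw [Linear.smul_comp, Linear.comp_smul, K.kirbyEnd_comp_kirbyEnd hO hA,
      inv_smul_smul₀ hD]
  obtain ⟨A', i, p, hip, hpi⟩ := IsIdempotentComplete.idempotents_split A _ hidem
  have hA' : K.deg 1 A' := K.deg_of_retract hA i p hip
  refine ⟨A', i, p, (K.isTransparent_iff hA').mpr fun B hB => ?_, fun T m _ hT => ⟨m ≫ p, ?_⟩,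
    hip, hpi.symm⟩
  -- The inclusion factors through the idempotent, so it absorbs the monodromy of `A`. Naturality
  -- transfers this to `A'`, and `p` cancels `i`.
  · have hi : i = i ≫ ((K.kirbyColour O 1).dim⁻¹ • K.kirbyEnd O hA) := by
      rw [← hpi, reassoc_of% hip]
    have hsl : i ▷ B ≫ K.monodromy hA hB ≫ K.oneIso.hom.app A ▷ B = i ▷ B := by
      rw [hi, Linear.comp_smul, MonoidalLinear.smul_whiskerRight, comp_whiskerRight,
        Linear.smul_comp, Category.assoc, K.kirbyEnd_slide hO hA hB]
    have hnat : (K.act 1).map i ≫ K.oneIso.hom.app A = K.oneIso.hom.app A' ≫ i :=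
      K.oneIso.hom.naturality i
    rw [reassoc_of% (K.monodromy_naturality_left hA' hA hB i), ← comp_whiskerRight, hnat,
      comp_whiskerRight] at hsl
    have hsl' := congrArg (· ≫ p ▷ B) hsl
    have hone : K.oneIso.hom.app A' ≫ 𝟙 A' = K.oneIso.hom.app A' := Category.comp_id _
    simp only [Category.assoc, ← comp_whiskerRight, hip, id_whiskerRight] at hsl'
    rwa [hone] at hsl'
  · obtain ⟨hT1, -⟩ := id hT
    rw [Category.assoc, hpi, Linear.comp_smul, K.kirbyEnd_naturality hT1 hA,
      K.kirbyEnd_of_isTransparent hT1 hT, Linear.smul_comp, Category.id_comp,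
      inv_smul_smul₀ hD]

/-- Maximality gives both idempotents the same image. Naturality of `kirbyEnd` makes them commute,
and commuting idempotents with equal images coincide. -/
theorem eq_of_isTransparentProjection (hO : IsSimpleReps O) {A : C} (hA : K.deg 1 A) (τ : A ⟶ A)
    (hτ : K.IsTransparentProjection τ) : τ = (K.kirbyColour O 1).dim⁻¹ • K.kirbyEnd O hA := by
  have hcomm : τ ≫ ((K.kirbyColour O 1).dim⁻¹ • K.kirbyEnd O hA) =
      ((K.kirbyColour O 1).dim⁻¹ • K.kirbyEnd O hA) ≫ τ := by
    rw [Linear.comp_smul, K.kirbyEnd_naturality hA hA, Linear.smul_comp]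
  obtain ⟨A', i, p, hA', hmax, hip, rfl⟩ := hτ
  obtain ⟨A'', i', p', hA'', hmax', hip', h'⟩ := K.isTransparentProjection_kirbyEnd hO hA
  rw [h'] at hcomm ⊢
  have : Mono i := mono_of_mono_fac (h := 𝟙 A') hip
  have : Mono i' := mono_of_mono_fac (h := 𝟙 A'') hip'
  obtain ⟨k, hk⟩ := hmax' A' i hA'
  obtain ⟨k', hk'⟩ := hmax A'' i' hA''
  calc
    p ≫ i = (p ≫ i) ≫ p' ≫ i' := by
      rw [← hk]; simp only [Category.assoc, reassoc_of% hip']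
    _ = (p' ≫ i') ≫ p ≫ i := hcomm
    _ = p' ≫ i' := by
      rw [← hk']; simp only [Category.assoc, reassoc_of% hip]

theorem exists_simple_of_deg {g : G} {Y : C} (hY : K.deg g Y) (hY0 : ¬ IsZero Y) :
    ∃ S : C, Simple S ∧ K.deg g S := by
  by_contra! h
  refine hY0 ((IsZero.iff_id_eq_zero _).mpr (eq_zero_of_simple_comp_eq_zero _ fun S hS r => ?_))
  by_contra hr
  exact h S hS (K.deg_of_simple_hom_ne_zero hY r (by simpa using hr))

theorem kirbyColour_encircling_comp_inv (hO : IsSimpleReps O) {g : G}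
    (hg : ∃ Y : C, K.deg g Y ∧ ¬ IsZero Y) {A : C} (hA : K.deg 1 A) :
    (K.kirbyColour O g).encircling hA ≫ (K.kirbyColour O g⁻¹).encircling (K.deg_act_one g hA) ≫
        (K.invActIso g A).hom =
      (K.kirbyColour O 1).dim • K.kirbyEnd O hA := by
  obtain ⟨Y, hY, hY0⟩ := hg
  have h := K.kirbyColour_encircling_comp hO (inv_mul_cancel g) hA
  rw [K.dim_kirbyColour_eq hO (mul_inv_cancel g) hY hY0] at h
  have h' := congrArg (· ≫ K.oneIso.hom.app A) h
  simp only [Category.assoc, Linear.smul_comp] at h'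
  exact h'

/-- By Schur `kirbyEnd` is a scalar; were it nonzero, it could be cancelled from `kirbyEnd_slide`,
leaving the transparency of `X`. -/
theorem kirbyEnd_eq_zero_of_not_isTransparent (hO : IsSimpleReps O) {X : C} [Simple X]
    (hX : K.deg 1 X) (h : ¬ K.IsTransparent X) : K.kirbyEnd O hX = 0 := by
  obtain ⟨s, hs⟩ := endomorphism_simple_eq_smul_id ℂ (K.kirbyEnd O hX)
  by_cases hs0 : s = 0
  · rw [← hs, hs0, zero_smul]
  · refine absurd ((K.isTransparent_iff hX).mpr fun B hB => ?_) h
    have hsl := K.kirbyEnd_slide hO hX hB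
    rw [← hs, MonoidalLinear.smul_whiskerRight, id_whiskerRight, Linear.smul_comp,
      Category.id_comp] at hsl
    exact smul_right_injective _ hs0 hsl

theorem kirbyColour_encircling_eq_zero (hO : IsSimpleReps O) {g : G}
    (hg : ∃ Y : C, K.deg g Y ∧ ¬ IsZero Y) {X : C} [Simple X] (hX : K.deg 1 X)
    (h : ¬ K.IsTransparent X) : (K.kirbyColour O g).encircling hX = 0 := by
  obtain ⟨Y, hY, hY0⟩ := hg
  obtain ⟨S, hS, hSg⟩ := K.exists_simple_of_deg hY hY0
  have h1 : (K.kirbyColour O 1).encircling hX = 0 := by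
    have h0 := K.kirbyEnd_eq_zero_of_not_isTransparent hO hX h
    rwa [kirbyEnd, Preadditive.IsIso.comp_right_eq_zero] at h0
  -- Encircling by `Ω_e` and then by `S` equals `dim S` times encircling by `Ω_g`, and `dim S ≠ 0`.
  have h2 := K.kirbyColour_encircling_comp_encircling hO (_root_.mul_one g) hX hSg
  rw [h1, zero_comp] at h2
  exact (smul_eq_zero.mp h2.symm).resolve_left (qdim_ne_zero S)

theorem kirbyColour_encircling_hom_inv (hO : IsSimpleReps O) {g : G}
    (hg : ∃ Y : C, K.deg g Y ∧ ¬ IsZero Y) {X : C} (hX : K.deg 1 X) (h : K.IsTransparent X) :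
    (K.kirbyColour O g).encircling hX ≫ (((K.kirbyColour O 1).dim ^ 2)⁻¹ •
      ((K.kirbyColour O g⁻¹).encircling (K.deg_act_one g hX) ≫ (K.invActIso g X).hom)) = 𝟙 X := by
  rw [Linear.comp_smul, K.kirbyColour_encircling_comp_inv hO hg hX,
    K.kirbyEnd_of_isTransparent hX h, smul_smul (K.kirbyColour O 1).dim, ← sq,
    inv_smul_smul₀ (pow_ne_zero 2 (K.dim_kirbyColour_one_ne_zero hO))]

theorem kirbyColour_encircling_inv_hom (hO : IsSimpleReps O) {g : G}
    (hg : ∃ Y : C, K.deg g Y ∧ ¬ IsZero Y) {X : C} [Simple X] (hX : K.deg 1 X)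
    (h : K.IsTransparent X) :
    (((K.kirbyColour O 1).dim ^ 2)⁻¹ • ((K.kirbyColour O g⁻¹).encircling (K.deg_act_one g hX) ≫
      (K.invActIso g X).hom)) ≫ (K.kirbyColour O g).encircling hX = 𝟙 ((K.act g).obj X) := by
  have h1 := K.kirbyColour_encircling_hom_inv hO hg hX h
  -- `ᵍX` is simple too, so the nonzero encircling is invertible and its one-sided inverse is
  -- two-sided.
  have := K.simple_act g X
  have hne : (K.kirbyColour O g).encircling hX ≠ 0 := by
    intro h0
    rw [h0, zero_comp] at h1
    exact id_nonzero X h1.symm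
  have := isIso_of_hom_simple hne
  rw [← cancel_epi ((K.kirbyColour O g).encircling hX), reassoc_of% h1, Category.comp_id]

end CrossedBraided

end GCross

end

theorem mainTheorem8 {G : Type w} [Group G] [Finite G]
    {C : Type u} [Category.{v} C] [Abelian C] [Linear ℂ C] [MonoidalCategory C]
    [MonoidalPreadditive C] [MonoidalLinear ℂ C] [RigidCategory C] [GCross.FusionCategory C]
    [GCross.PivotalCategory C] [GCross.SphericalCategory C]
    (K : GCross.CrossedBraided G C) (O : Finset C) (hO : GCross.IsSimpleReps O)
    (g : G) (hg : ∃ Y : C, K.deg g Y ∧ ¬ IsZero Y) :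
    (∀ (A : C) (hA : K.deg 1 A),
      ∃ τ : A ⟶ A, K.IsTransparentProjection τ ∧
        (∀ τ' : A ⟶ A, K.IsTransparentProjection τ' → τ' = τ) ∧
        (K.kirbyColour O g).encircling hA ≫
            (K.kirbyColour O g⁻¹).encircling (K.deg_act_one g hA) ≫ (K.invActIso g A).hom =
          (K.kirbyColour O 1).dim ^ 2 • τ) ∧
    (∀ (X : C) (hX : K.deg 1 X), Simple X →
      (IsIso ((K.kirbyColour O g).encircling hX) ↔ K.IsTransparent X) ∧
      (K.IsTransparent X →
        (K.kirbyColour O 1).dim ≠ 0 ∧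
        (K.kirbyColour O g).encircling hX ≫
            (((K.kirbyColour O 1).dim ^ 2)⁻¹ •
              ((K.kirbyColour O g⁻¹).encircling (K.deg_act_one g hX) ≫ (K.invActIso g X).hom)) =
          𝟙 X ∧
        (((K.kirbyColour O 1).dim ^ 2)⁻¹ •
            ((K.kirbyColour O g⁻¹).encircling (K.deg_act_one g hX) ≫ (K.invActIso g X).hom)) ≫
            (K.kirbyColour O g).encircling hX =
          𝟙 ((K.act g).obj X)) ∧
      (¬ K.IsTransparent X → (K.kirbyColour O g).encircling hX = 0)) := by
  refine ⟨fun A hA => ⟨_, K.isTransparentProjection_kirbyEnd hO hA,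
    fun τ' hτ' => K.eq_of_isTransparentProjection hO hA τ' hτ', ?_⟩, fun X hX hS => ?_⟩
  · rw [K.kirbyColour_encircling_comp_inv hO hg hA, sq, mul_smul,
      smul_inv_smul₀ (K.dim_kirbyColour_one_ne_zero hO)]
  · refine ⟨⟨fun hiso => ?_, fun h => ⟨_, K.kirbyColour_encircling_hom_inv hO hg hX h,
      K.kirbyColour_encircling_inv_hom hO hg hX h⟩⟩, fun h => ⟨K.dim_kirbyColour_one_ne_zero hO,
      K.kirbyColour_encircling_hom_inv hO hg hX h, K.kirbyColour_encircling_inv_hom hO hg hX h⟩,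
      K.kirbyColour_encircling_eq_zero hO hg hX⟩
    by_contra h
    have h0 := K.kirbyColour_encircling_eq_zero hO hg hX h
    refine id_nonzero X ?_
    rw [← cancel_mono ((K.kirbyColour O g).encircling hX), h0, comp_zero, comp_zero]
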